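/- **Conventions.** A tuple generating dependency (TGD) is a rule $\Phi(\bar x,\bar y)\Rightarrow\exists\bar z\,\Psi(\bar x,\bar z)$ with conjunctions of relational atoms $\Phi$ (body) and $\Psi$ (head), without equality and constants; it is single-head if $\Psi$ is one atom. A program is a finite set of TGDs. It is called ternary if all its relations have arity $1$, $2$ or $3$. A database instance is a finite set of ground atoms. A step of the Standard Chase of a program $\mathcal T$ picks a rule of $\mathcal T$ and elements $\bar a,\bar b$ such that, in the current instance, $\Phi(\bar a,\bar b)$ is true and $\exists\bar z\,\Psi(\bar a,\bar z)$ is false, and adds the atoms of $\Psi(\bar a,\bar c)$, where $\bar c$ is a tuple of pairwise distinct new elements. $\mathcal T$ has all-instances-all-paths Standard Chase termination if, for every database instance $D$, there is no infinite sequence of such steps that starts from $D$. A three-counter automaton (3CM) $M$ is deterministic with $m\ge 1$ states $1,\dots,m$, of which $1$ is initial. Its partial transition function depends on the state and on whether the first and whether the second counter is zero; it changes the state, increments, decrements or keeps each of the first two counters (decrementing $0$ gives $0$), and increments the third counter. $M$ halts if, started in state $1$ with three empty counters, it reaches a configuration in which no instruction is applicable. Let $p_1=2,p_2=3,\dots,p_{m+3}$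 be the first $m+3$ primes and $p=p_1\cdots p_{m+3}$. A configuration $\mathbf c$ with state $i$ and counters $c_1,c_2,c_3$ is encoded by $e(\mathbf c)=p_i\,p_{m+1}^{c_1}p_{m+2}^{c_2}p_{m+3}^{c_3}$. Its consecutive configuration $\mathbf c'$ is the result of one step of $M$, or $\mathbf c$ itself if no instruction is applicable. Positive integers $q_0,\dots,q_{p-1},r_0,\dots,r_{p-1}$ are a Conway coding of $M$ if for every configuration $\mathbf c$ and for $i=e(\mathbf c)\bmod p$ we have $r_i\mid e(\mathbf c)$ and $e(\mathbf c')=q_i\,e(\mathbf c)/r_i$. Given these, let $g(n)=\lfloor nq_i/r_i\rfloor$ with $i=n\bmod p$, and let $\mathcal G=\{g^k(2):k\in\mathbb N\}$ be the Conway orbit. The program $\mathcal T_M$ (for the given coding) has unary relations $H,N$, binary relations $E$, $G$, $E^j$ for $j\in\{q_0,\dots,q_{p-1},r_0,\dots,r_{p-1}\}$ and $R^i$ for $0\le i<p$, ternary relations $T^i$ for $0\le i<p$, and the rules (for all these $j$ and $i$) * $G(x,y),H(y)\Rightarrow\exists z\,E(z,x)$; * $E(y_0,y_1),\dots,E(y_{j-1},y_j)\Rightarrow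 E^j(y_0,y_j)$; $\quad E(z,x)\Rightarrow N(z)$; * $N(x)\Rightarrow T^i(x,x,x)$; $\quad T^i(x,y,z),E^{q_i}(y,y'),E^{r_i}(z,z')\Rightarrow T^i(x,y',z')$; * $N(x)\Rightarrow R^0(x,x)$; $\quad R^i(x,y),E(y,y')\Rightarrow R^{(i+1)\bmod p}(x,y')$; * $E(x,y),E(y,z)\Rightarrow G(x,z)$; $\quad R^i(x,y),G(x,y),T^i(x,z,y)\Rightarrow G(x,z)$. A well of positivity is an element $a$ such that $R(a,\dots,a)$ is true for every relation $R$ of the signature. **Theorem.** (1) There is no algorithm that decides, for a given program consisting of single-head TGDs (with non-empty bodies) over a ternary signature, whether it has all-instances-all-paths Standard Chase termination. (2) Every 3CM $M$ has a Conway coding, and for every Conway coding of $M$: (a) $\mathcal T_M$ is a program of single-head TGDs with non-empty bodies over a ternary signature; (b) $M$ halts if and only if $\mathcal G$ is bounded; (c) if $\mathcal G$ is bounded, then the $\mathcal T_M$-Standard Chase terminates on every instance and along every execution path; (d) if $\mathcal G$ is unbounded, then the $\mathcal T_M$-Standard Chase has a non-terminating execution path on the instance $D$ that consists of a well of positivity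 $a$ (that is, of all atoms $R(a,\dots,a)$, $R$ a relation of $\mathcal T_M$) and of one further element $b$ with the single additional atom $E(b,a)$. -/

import Mathlib

namespace Chase

/-! ### Atoms, rules, programs, instances -/

/-- An atom: the name of a relation symbol and the list of its arguments. A relation symbol is
identified by its name *together with its arity* (the length of the argument list). The arguments
are variables (when the atom occurs in a rule) or elements (when the atom occurs in a database
instance); both are named by natural numbers. -/
abbrev Atom := ℕ × List ℕ

/-- The atom obtained by evaluating the arguments under a valuation `v`. -/
def Atom.subst (a : Atom) (v : ℕ → ℕ) : Atom := (a.1, a.2.map v)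

/-- A tuple generating dependency `Φ(x̄,ȳ) ⇒ ∃ z̄ Ψ(x̄,z̄)`: the pair (body `Φ`, head `Ψ`) of
conjunctions of atoms. The existentially quantified variables `z̄` are the variables that occur in
the head and do not occur in the body. -/
abbrev TGD := List Atom × List Atom

/-- A program is a finite set (given as a list) of tuple generating dependencies. -/
abbrev Program := List TGD

/-- A database instance: a finite set of ground atoms. -/
abbrev Instance := Finset Atom

/-- The variables of a conjunction of atoms. -/
def vars (A : List Atom) : Set ℕ := {x | ∃ a ∈ A, x ∈ a.2}

/-- The active domain of an instance: the elements that occur in its atoms. -/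
def adom (I : Instance) : Set ℕ := {x | ∃ a ∈ I, x ∈ a.2}

/-- The conjunction `A` is true in `I` under the valuation `v`. -/
def Holds (I : Instance) (A : List Atom) (v : ℕ → ℕ) : Prop := ∀ a ∈ A, a.subst v ∈ I

/-- The relation symbols, as pairs (name, arity), that occur in a program. -/
def Program.signature (P : Program) : Finset (ℕ × ℕ) :=
  ((P.flatMap fun ρ => ρ.1 ++ ρ.2).map fun a => (a.1, a.2.length)).toFinset

/-- Programs consisting of single-head TGDs with non-empty bodies over a ternary signature, that
is, one in which all relations have arity one, two or three. -/
def Program.IsSingleHeadTernary (P : Program) : Prop :=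
  (∀ ρ ∈ P, ρ.1 ≠ [] ∧ ρ.2.length = 1) ∧ ∀ s ∈ P.signature, 1 ≤ s.2 ∧ s.2 ≤ 3

/-! ### Standard Chase -/

/-- The trigger `(ρ, v)` is active in `I` in the sense of the Standard Chase: the body of `ρ` is
true under `v`, and `v`, restricted to the variables of the body, has no extension that makes the
head true. -/
def IsActive (I : Instance) (ρ : TGD) (v : ℕ → ℕ) : Prop :=
  Holds I ρ.1 v ∧ ¬ ∃ w : ℕ → ℕ, (∀ x ∈ vars ρ.1, w x = v x) ∧ Holds I ρ.2 w

/-- One step of the Standard Chase: for some active trigger, the existential variables of the rule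
are sent to pairwise distinct new elements and the head is added to the instance. -/
def StandardStep (P : Program) (I J : Instance) : Prop :=
  ∃ ρ ∈ P, ∃ v : ℕ → ℕ, IsActive I ρ v ∧
    ∃ w : ℕ → ℕ, (∀ x ∈ vars ρ.1, w x = v x) ∧
      (∀ z ∈ vars ρ.2 \ vars ρ.1, w z ∉ adom I) ∧
      Set.InjOn w (vars ρ.2 \ vars ρ.1) ∧
      J = I ∪ (ρ.2.map fun a => a.subst w).toFinset

/-- The sequence `s` is a non-terminating execution path of the Standard Chase on `D`. -/
def IsNonterminatingPath (P : Program) (D : Instance) (s : ℕ → Instance) : Prop :=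
  s 0 = D ∧ ∀ n, StandardStep P (s n) (s (n + 1))

/-- All-instances-all-paths termination of the Standard Chase: on no database instance is there a
non-terminating execution path. -/
def TerminatesAllInstancesAllPaths (P : Program) : Prop :=
  ∀ D : Instance, ¬ ∃ s : ℕ → Instance, IsNonterminatingPath P D s

/-- The instance that consists of a single element `a` which is a well of positivity:
`R(a, …, a)` is true for every relation symbol `R` of the signature `S`. -/
def well (S : Finset (ℕ × ℕ)) (a : ℕ) : Instance :=
  S.image fun s => (s.1, List.replicate s.2 a)

/-! ### Three-counter automata -/

/-- What an instruction does to the first or to the second counter. -/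
inductive CounterOp
  | increment
  | decrement
  | keep

/-- The effect on a counter value (decrementing the value zero has no effect). -/
def CounterOp.apply : CounterOp → ℕ → ℕ
  | increment, c => c + 1
  | decrement, c => c - 1
  | keep, c => c

/-- A deterministic automaton with three counters. Its states are `Fin (lastState + 1)`, and `0` is
the initial state. The partial function `instr` gives, for a state and the answers to the questions
"is the first counter zero?" and "is the second counter zero?", the new state and the operations on
the first and the second counter. -/
structure ThreeCM where
  lastState : ℕ
  instr : Fin (lastState + 1) → Bool → Bool → Option (Fin (lastState + 1) × CounterOp × CounterOp)

/-- Configurations: the state and the values of the three counters. -/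
structure Config (M : ThreeCM) where
  state : Fin (M.lastState + 1)
  c₁ : ℕ
  c₂ : ℕ
  c₃ : ℕ

namespace ThreeCM

/-- A single step of the automaton, `none` if no instruction is applicable. The third counter is
incremented in every step. -/
def step (M : ThreeCM) (c : Config M) : Option (Config M) :=
  (M.instr c.state (decide (c.c₁ = 0)) (decide (c.c₂ = 0))).map fun a =>
    ⟨a.1, a.2.1.apply c.c₁, a.2.2.apply c.c₂, c.c₃ + 1⟩

/-- The configuration consecutive to `c`; it is `c` itself if no instruction is applicable. -/
def next (M : ThreeCM) (c : Config M) : Config M := (M.step c).getD c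

/-- The initial configuration: the initial state and three empty counters. -/
def init (M : ThreeCM) : Config M := ⟨0, 0, 0, 0⟩

/-- `M` halts when started from the initial configuration. -/
def Halts (M : ThreeCM) : Prop := ∃ k : ℕ, M.step (M.next^[k] M.init) = none

/-! ### The encoding as a Conway function -/

/-- The `k`-th prime, counted from zero: `2, 3, 5, …`. -/
noncomputable def prime (k : ℕ) : ℕ := Nat.nth Nat.Prime k

/-- With `m` states, the product of the first `m + 3` primes. -/
noncomputable def modulus (M : ThreeCM) : ℕ := ∏ k ∈ Finset.range (M.lastState + 1 + 3), prime k

/-- The encoding of a configuration: the prime of its state times the prime powers of the three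
counters. -/
noncomputable def encode (M : ThreeCM) (c : Config M) : ℕ :=
  prime c.state * prime (M.lastState + 1) ^ c.c₁ * prime (M.lastState + 2) ^ c.c₂ *
    prime (M.lastState + 3) ^ c.c₃

/-- The positive numbers `q i`, `r i` with `i < p` (where `p` is the modulus) simulate `M`: if the
encoding of a configuration is congruent to `i` modulo `p`, then it is divisible by `r i`, and
dividing it by `r i` and multiplying by `q i` gives the encoding of the consecutive
configuration. (Values of `q` and `r` at arguments `≥ p` are irrelevant.) -/
def IsConwayCoding (M : ThreeCM) (q r : ℕ → ℕ) : Prop :=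
  (∀ i < M.modulus, 0 < q i ∧ 0 < r i) ∧
    ∀ c : Config M, ∀ i < M.modulus, M.encode c % M.modulus = i →
      r i ∣ M.encode c ∧ M.encode (M.next c) = q i * M.encode c / r i

end ThreeCM

/-- The Conway function `n ↦ n qᵢ / rᵢ`, where `i` is the residue of `n` modulo `p`. -/
def conway (p : ℕ) (q r : ℕ → ℕ) (n : ℕ) : ℕ := n * q (n % p) / r (n % p)

/-- The orbit of `2` under the Conway function. -/
def conwayOrbit (p : ℕ) (q r : ℕ → ℕ) : Set ℕ := {x | ∃ k : ℕ, (conway p q r)^[k] 2 = x}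

/-! ### The program of an automaton -/

/-- The (binary) relation `E`. -/
def relE : ℕ := 0
/-- The (unary) relation `H`. -/
def relH : ℕ := 1
/-- The (unary) relation `N`. -/
def relN : ℕ := 2
/-- The (binary) relation `G`. -/
def relG : ℕ := 3
/-- The (binary) relation `E^j`. -/
def relPow (j : ℕ) : ℕ := 4 + 3 * j
/-- The (ternary) relation `T^i`. -/
def relT (i : ℕ) : ℕ := 5 + 3 * i
/-- The (binary) relation `R^i`. -/
def relR (i : ℕ) : ℕ := 6 + 3 * i

/-- The numbers `q₀, …, q_{p-1}, r₀, …, r_{p-1}`. -/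
def multipliers (p : ℕ) (q r : ℕ → ℕ) : List ℕ := (List.range p).map q ++ (List.range p).map r

/-- The program with the only existential rule `G_x(y), H(y) ⇒ ∃ z E(z,x)`, and Datalog rules. -/
def conwayProgram (p : ℕ) (q r : ℕ → ℕ) : Program :=
  -- `G(x,y), H(y) ⇒ ∃ z, E(z,x)`
  [([(relG, [0, 1]), (relH, [1])], [(relE, [2, 0])])] ++
  -- `E(y₀,y₁), …, E(y_{j-1},y_j) ⇒ E^j(y₀,y_j)`
  ((multipliers p q r).map fun j =>
    ((List.range j).map fun k => (relE, [k, k + 1]), [(relPow j, [0, j])])) ++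
  -- `E(z,x) ⇒ N(z)`
  [([(relE, [0, 1])], [(relN, [0])])] ++
  -- `N(x) ⇒ T^i(x,x,x)`
  ((List.range p).map fun i => ([(relN, [0])], [(relT i, [0, 0, 0])])) ++
  -- `T^i(x,y,z), E^{q_i}(y,y'), E^{r_i}(z,z') ⇒ T^i(x,y',z')`
  ((List.range p).map fun i =>
    ([(relT i, [0, 1, 2]), (relPow (q i), [1, 3]), (relPow (r i), [2, 4])],
      [(relT i, [0, 3, 4])])) ++
  -- `N(x) ⇒ R^0(x,x)`
  [([(relN, [0])], [(relR 0, [0, 0])])] ++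
  -- `R^i(x,y), E(y,y') ⇒ R^j(x,y')` with `j = i + 1` modulo `p`
  ((List.range p).map fun i =>
    ([(relR i, [0, 1]), (relE, [1, 2])], [(relR ((i + 1) % p), [0, 2])])) ++
  -- `E(x,y), E(y,z) ⇒ G(x,z)`
  [([(relE, [0, 1]), (relE, [1, 2])], [(relG, [0, 2])])] ++
  -- `R^i(x,y), G(x,y), T^i(x,z,y) ⇒ G(x,z)`
  ((List.range p).map fun i =>
    ([(relR i, [0, 1]), (relG, [0, 1]), (relT i, [0, 2, 1])], [(relG, [0, 2])]))

/-- The program `T_M` of the automaton `M`, for given numbers `q`, `r`. -/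
noncomputable def ThreeCM.program (M : ThreeCM) (q r : ℕ → ℕ) : Program :=
  conwayProgram M.modulus q r

/-- The well of positivity (the element `0`) over the signature of `P`, together with one extra
element `1` such that `E(1,0)`. -/
def wellWithPredecessor (P : Program) : Instance :=
  insert ((relE, [1, 0]) : Atom) (well P.signature 0)

end Chase

namespace Chase

/-! ### Chase steps of the Conway program -/

/-! Along a chain of `E`-edges the Datalog rules compute the Conway function on distances:
`R^i(x,y)` records the distance modulo `p`, `T^i(x,y,z)` says that `y` and `z` lie at distances `q_i
t` and `r_i t` from `x`, and so `G(x,·)` passes from distance `n` to distance `g(n)`, starting from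
`2`. The only rule that creates elements gives `x` a predecessor, provided that it has none and that
`G` leads from `x` to an element satisfying `H`.

Suppose the orbit is bounded by `B`. Since an element receives a predecessor only if it has none,
the new elements form unbranched chains hanging from the original ones, and each is determined by a
root and a depth. The given instance may hold arbitrary atoms among elements of depth `0`, but atoms
that involve sufficiently deep elements describe true distances (`Layered`). From depth greater than
`B`, `G` therefore leads only to positive depth, where `H` fails because no rule derives `H`. Depths
never exceed `B + 1`, only finitely many atoms are available up to renaming, and every step adds one
(`terminates_of_bddAbove`).

Suppose the orbit is unbounded. A chain `m → ⋯ → 0` with a loop at the well `0` is modelled by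
truncated subtraction: the element `n` edges after `m` is `m - n`. An orbit element above `m` yields
`G(m,0)`, and the chain can be prolonged (`exists_taller_tower`).

Codings exist because the residue of a number modulo a product of distinct primes shows which of
these primes divide it, hence the state and the zero tests (`exists_coding`). The clock counter
makes boundedness of the orbit equivalent to halting.

Undecidability does not pass through three counters. One register program, built from the register
computability of primitive recursive functions and an unbounded search, is universal; it is encoded
with as many primes as it needs, and its input enters through the single multiplier `q 2`, applied
to the starting value `2` (`Prog.exists_conway`). The resulting rule programs are primitive
recursive in the input. -/

theorem subst_eq_of_agree {b : List Atom} {h : Atom} (hv : vars [h] ⊆ vars b) {v w : ℕ → ℕ}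
    (hw : ∀ x ∈ vars b, w x = v x) : h.subst w = h.subst v := by
  unfold Atom.subst
  congr 1
  exact List.map_congr_left fun x hx => hw x (hv ⟨h, by simp, hx⟩)

theorem standardStep_of_datalog {P : Program} {I : Instance} {b : List Atom} {h : Atom}
    (hP : ((b, [h]) : TGD) ∈ P) (hv : vars [h] ⊆ vars b) (v : ℕ → ℕ) (hb : Holds I b v)
    (hh : h.subst v ∉ I) : StandardStep P I (insert (h.subst v) I) := by
  refine ⟨_, hP, v, ⟨hb, ?_⟩, v, fun _ _ => rfl, ?_, ?_, ?_⟩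
  · rintro ⟨w, hw, hw'⟩
    apply hh
    rw [← subst_eq_of_agree hv hw]
    exact hw' h (by simp)
  · intro z hz
    exact absurd (hv hz.1) hz.2
  · intro z hz
    exact absurd (hv hz.1) hz.2
  · ext a
    simp [or_comm]

theorem datalog_of_isActive {I : Instance} {b : List Atom} {h : Atom} {v w : ℕ → ℕ}
    (hv : vars [h] ⊆ vars b) (hact : IsActive I (b, [h]) v) (hw : ∀ x ∈ vars b, w x = v x) :
    h.subst w = h.subst v ∧ h.subst v ∉ I := by
  refine ⟨subst_eq_of_agree hv hw, fun hI => hact.2 ⟨v, fun _ _ => rfl, ?_⟩⟩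
  intro a ha
  simp only [List.mem_singleton] at ha
  exact ha ▸ hI

/-- The atoms obtained by applying a Datalog rule of the Conway program to the instance `I`. -/
inductive Derives (p : ℕ) (q r : ℕ → ℕ) (I : Instance) : Atom → Prop
  | pow (j : ℕ) (hj : j ∈ multipliers p q r) (y : ℕ → ℕ)
      (h : ∀ k < j, ((relE, [y k, y (k + 1)]) : Atom) ∈ I) : Derives p q r I (relPow j, [y 0, y j])
  | node (z x : ℕ) (h : ((relE, [z, x]) : Atom) ∈ I) : Derives p q r I (relN, [z])
  | ratioBase (i x : ℕ) (hi : i < p) (h : ((relN, [x]) : Atom) ∈ I) :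
      Derives p q r I (relT i, [x, x, x])
  | ratioStep (i x y z y' z' : ℕ) (hi : i < p) (h : ((relT i, [x, y, z]) : Atom) ∈ I)
      (hq : ((relPow (q i), [y, y']) : Atom) ∈ I) (hr : ((relPow (r i), [z, z']) : Atom) ∈ I) :
      Derives p q r I (relT i, [x, y', z'])
  | residueBase (x : ℕ) (h : ((relN, [x]) : Atom) ∈ I) : Derives p q r I (relR 0, [x, x])
  | residueStep (i x y y' : ℕ) (hi : i < p) (h : ((relR i, [x, y]) : Atom) ∈ I)
      (hE : ((relE, [y, y']) : Atom) ∈ I) : Derives p q r I (relR ((i + 1) % p), [x, y'])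
  | orbitBase (x y z : ℕ) (h : ((relE, [x, y]) : Atom) ∈ I) (h' : ((relE, [y, z]) : Atom) ∈ I) :
      Derives p q r I (relG, [x, z])
  | orbitStep (i x y z : ℕ) (hi : i < p) (hR : ((relR i, [x, y]) : Atom) ∈ I)
      (hG : ((relG, [x, y]) : Atom) ∈ I) (hT : ((relT i, [x, z, y]) : Atom) ∈ I) :
      Derives p q r I (relG, [x, z])

theorem mem_conwayProgram {p : ℕ} {q r : ℕ → ℕ} {ρ : TGD} :
    ρ ∈ conwayProgram p q r ↔
      ρ = ([(relG, [0, 1]), (relH, [1])], [(relE, [2, 0])]) ∨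
      (∃ j ∈ multipliers p q r,
        ((List.range j).map fun k => (relE, [k, k + 1]), [(relPow j, [0, j])]) = ρ) ∨
      ρ = ([(relE, [0, 1])], [(relN, [0])]) ∨
      (∃ i < p, ([(relN, [0])], [(relT i, [0, 0, 0])]) = ρ) ∨
      (∃ i < p, ([(relT i, [0, 1, 2]), (relPow (q i), [1, 3]), (relPow (r i), [2, 4])],
        [(relT i, [0, 3, 4])]) = ρ) ∨
      ρ = ([(relN, [0])], [(relR 0, [0, 0])]) ∨
      (∃ i < p, ([(relR i, [0, 1]), (relE, [1, 2])], [(relR ((i + 1) % p), [0, 2])]) = ρ) ∨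
      ρ = ([(relE, [0, 1]), (relE, [1, 2])], [(relG, [0, 2])]) ∨
      (∃ i < p, ([(relR i, [0, 1]), (relG, [0, 1]), (relT i, [0, 2, 1])],
        [(relG, [0, 2])]) = ρ) := by
  simp only [conwayProgram, List.mem_append, List.mem_map, List.mem_range, List.mem_singleton,
    or_assoc]

theorem pos_of_mem_multipliers {p : ℕ} {q r : ℕ → ℕ} (hqr : ∀ i < p, 0 < q i ∧ 0 < r i) {j : ℕ}
    (hj : j ∈ multipliers p q r) : 0 < j := by
  simp only [multipliers, List.mem_append, List.mem_map, List.mem_range] at hj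
  rcases hj with ⟨i, hi, rfl⟩ | ⟨i, hi, rfl⟩
  exacts [(hqr i hi).1, (hqr i hi).2]

/-- Positivity is essential: for `j = 0` the body is empty and the head variable would become
existential. -/
theorem vars_powRule {j : ℕ} (hj : 0 < j) :
    vars [((relPow j, [0, j]) : Atom)] ⊆
      vars ((List.range j).map fun k => ((relE, [k, k + 1]) : Atom)) := by
  rintro x ⟨a, ha, hx⟩
  simp only [List.mem_singleton] at ha
  subst ha
  simp only [List.mem_cons, List.not_mem_nil, or_false] at hx
  rcases hx with rfl | rfl
  · exact ⟨(relE, [0, 1]), List.mem_map.2 ⟨0, by simpa using hj, rfl⟩, by simp⟩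
  · exact ⟨(relE, [x - 1, x - 1 + 1]), List.mem_map.2 ⟨x - 1, by simp; omega, rfl⟩,
      by simp; omega⟩

theorem isSingleHeadTernary_conwayProgram {p : ℕ} {q r : ℕ → ℕ}
    (hqr : ∀ i < p, 0 < q i ∧ 0 < r i) : (conwayProgram p q r).IsSingleHeadTernary := by
  constructor
  · intro ρ hρ
    rw [mem_conwayProgram] at hρ
    rcases hρ with rfl | ⟨j, hj, rfl⟩ | rfl | ⟨i, hi, rfl⟩ | ⟨i, hi, rfl⟩ | rfl | ⟨i, hi, rfl⟩ |
      rfl | ⟨i, hi, rfl⟩ <;> simp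
    exact (pos_of_mem_multipliers hqr hj).ne'
  · intro s hs
    simp only [Program.signature, List.mem_toFinset, List.mem_map, List.mem_flatMap] at hs
    obtain ⟨a, ⟨ρ, hρ, ha⟩, rfl⟩ := hs
    rw [mem_conwayProgram] at hρ
    rcases hρ with rfl | ⟨j, hj, rfl⟩ | rfl | ⟨i, hi, rfl⟩ | ⟨i, hi, rfl⟩ | rfl | ⟨i, hi, rfl⟩ |
      rfl | ⟨i, hi, rfl⟩ <;> simp at ha
    case inr.inl => rcases ha with ⟨k, hk, rfl⟩ | rfl <;> simp
    all_goals rcases ha with rfl | rfl | rfl | rfl <;> simp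

theorem standardStep_of_derives {p : ℕ} {q r : ℕ → ℕ} (hqr : ∀ i < p, 0 < q i ∧ 0 < r i)
    {I : Instance} {a : Atom} (ha : Derives p q r I a) (haI : a ∉ I) :
    StandardStep (conwayProgram p q r) I (insert a I) := by
  have key : ∀ (b : List Atom) (h : Atom) (v : ℕ → ℕ), (b, [h]) ∈ conwayProgram p q r →
      vars [h] ⊆ vars b → Holds I b v → h.subst v = a →
      StandardStep (conwayProgram p q r) I (insert a I) := by
    rintro b h v hP hv hb rfl
    exact standardStep_of_datalog hP hv v hb haI
  cases ha with
  | pow j hj y h =>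
    refine key _ _ y (mem_conwayProgram.2 (Or.inr (Or.inl ⟨j, hj, rfl⟩)))
      (vars_powRule (pos_of_mem_multipliers hqr hj)) ?_ rfl
    intro a ha
    simp only [List.mem_map, List.mem_range] at ha
    obtain ⟨k, hk, rfl⟩ := ha
    exact h k hk
  | node z x h =>
    -- Valuations are given by listing the values of variables `0, 1, …`; the default `0` concerns
    -- only variables absent from the rule.
    refine key _ _ (fun k => [z, x].getD k 0) (mem_conwayProgram.2
      (Or.inr (Or.inr (Or.inl rfl)))) ?_ ?_ rfl
    · simp [vars]
    · simpa [Holds, Atom.subst] using h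
  | ratioBase i x hi h =>
    refine key _ _ (fun k => [x].getD k 0) (mem_conwayProgram.2
      (Or.inr (Or.inr (Or.inr (Or.inl ⟨i, hi, rfl⟩))))) ?_ ?_ rfl
    · simp [vars]
    · simpa [Holds, Atom.subst] using h
  | ratioStep i x y z y' z' hi h hq hr =>
    refine key _ _ (fun k => [x, y, z, y', z'].getD k 0) (mem_conwayProgram.2
      (Or.inr (Or.inr (Or.inr (Or.inr (Or.inl ⟨i, hi, rfl⟩)))))) ?_ ?_ rfl
    · intro x; simp [vars]; tauto
    · simpa [Holds, Atom.subst] using ⟨h, hq, hr⟩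
  | residueBase x h =>
    refine key _ _ (fun k => [x].getD k 0) (mem_conwayProgram.2
      (Or.inr (Or.inr (Or.inr (Or.inr (Or.inr (Or.inl rfl))))))) ?_ ?_ rfl
    · simp [vars]
    · simpa [Holds, Atom.subst] using h
  | residueStep i x y y' hi h hE =>
    refine key _ _ (fun k => [x, y, y'].getD k 0) (mem_conwayProgram.2
      (Or.inr (Or.inr (Or.inr (Or.inr (Or.inr (Or.inr (Or.inl ⟨i, hi, rfl⟩)))))))) ?_ ?_ rfl
    · intro x; simp [vars]; tauto
    · simpa [Holds, Atom.subst] using ⟨h, hE⟩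
  | orbitBase x y z h h' =>
    refine key _ _ (fun k => [x, y, z].getD k 0) (mem_conwayProgram.2
      (Or.inr (Or.inr (Or.inr (Or.inr (Or.inr (Or.inr (Or.inr (Or.inl rfl))))))))) ?_ ?_ rfl
    · intro x; simp [vars]; tauto
    · simpa [Holds, Atom.subst] using ⟨h, h'⟩
  | orbitStep i x y z hi hR hG hT =>
    refine key _ _ (fun k => [x, y, z].getD k 0) (mem_conwayProgram.2
      (Or.inr (Or.inr (Or.inr (Or.inr (Or.inr (Or.inr (Or.inr (Or.inr ⟨i, hi, rfl⟩)))))))))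
      ?_ ?_ rfl
    · intro x; simp [vars]; tauto
    · simpa [Holds, Atom.subst] using ⟨hR, hG, hT⟩

theorem standardStep_predecessor {p : ℕ} {q r : ℕ → ℕ} {I : Instance} {x y z : ℕ}
    (hG : ((relG, [x, y]) : Atom) ∈ I) (hH : ((relH, [y]) : Atom) ∈ I)
    (hE : ∀ u, ((relE, [u, x]) : Atom) ∉ I) (hz : z ∉ adom I) :
    StandardStep (conwayProgram p q r) I (insert ((relE, [z, x]) : Atom) I) := by
  -- One valuation serves both as trigger and as its extension: variable `2`, sent to `z`, does not
  -- occur in the body.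
  refine ⟨_, mem_conwayProgram.2 (Or.inl rfl), fun k => [x, y, z].getD k 0, ⟨?_, ?_⟩,
    fun k => [x, y, z].getD k 0, fun _ _ => rfl, ?_, ?_, ?_⟩
  · simpa [Holds, Atom.subst] using ⟨hG, hH⟩
  · rintro ⟨w, hw, hw'⟩
    have h0 : w 0 = x := by simpa using hw 0 ⟨(relG, [0, 1]), by simp⟩
    have := hw' _ (List.mem_singleton_self _)
    simp only [Atom.subst, List.map_cons, List.map_nil, h0] at this
    exact hE _ this
  · intro k hk
    have : k = 2 := by
      simp [vars] at hk
      tauto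
    subst this
    simpa using hz
  · intro k hk k' hk' _
    simp [vars] at hk hk'
    omega
  · ext a
    simp [Atom.subst, or_comm]

/-- In every rule but the first, the head variables occur in the body, so an active trigger just
means a missing derived atom. This dichotomy reduces invariants of the chase to two cases. -/
theorem standardStep_cases {p : ℕ} {q r : ℕ → ℕ} (hqr : ∀ i < p, 0 < q i ∧ 0 < r i)
    {I J : Instance} (h : StandardStep (conwayProgram p q r) I J) :
    (∃ a, Derives p q r I a ∧ a ∉ I ∧ J = insert a I) ∨
    ∃ x y z, ((relG, [x, y]) : Atom) ∈ I ∧ ((relH, [y]) : Atom) ∈ I ∧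
      (∀ u, ((relE, [u, x]) : Atom) ∉ I) ∧ z ∉ adom I ∧ J = insert ((relE, [z, x]) : Atom) I := by
  obtain ⟨ρ, hρ, v, hact, w, hw, hnew, -, rfl⟩ := h
  have key : ∀ (b : List Atom) (h : Atom), ρ = (b, [h]) → vars [h] ⊆ vars b →
      (Holds I b v → Derives p q r I (h.subst v)) → ∃ a, Derives p q r I a ∧ a ∉ I ∧
        I ∪ (ρ.2.map fun a => a.subst w).toFinset = insert a I := by
    rintro b h rfl hv hd
    obtain ⟨h1, h2⟩ := datalog_of_isActive hv hact hw
    refine ⟨_, hd hact.1, h2, ?_⟩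
    ext a
    simp [h1, or_comm]
  rw [mem_conwayProgram] at hρ
  rcases hρ with rfl | ⟨j, hj, rfl⟩ | rfl | ⟨i, hi, rfl⟩ | ⟨i, hi, rfl⟩ | rfl | ⟨i, hi, rfl⟩ |
      rfl | ⟨i, hi, rfl⟩
  · right
    have hb := hact.1
    simp only [Holds, Atom.subst, List.mem_cons, List.not_mem_nil, or_false, forall_eq_or_imp,
      List.map_cons, List.map_nil, forall_eq] at hb
    have h0 : w 0 = v 0 := hw 0 ⟨(relG, [0, 1]), by simp⟩
    refine ⟨v 0, v 1, w 2, hb.1, hb.2, ?_, hnew 2 (by simp [vars]), ?_⟩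
    · intro u hu
      refine hact.2 ⟨Function.update v 2 u, ?_, ?_⟩
      · intro x hx
        simp [vars] at hx
        rw [Function.update_of_ne]
        omega
      · simpa [Holds, Atom.subst] using hu
    · ext a
      simp [Atom.subst, h0, or_comm]
  all_goals left
  · refine key _ _ rfl (vars_powRule (pos_of_mem_multipliers hqr hj)) fun hb => ?_
    refine .pow j hj v fun k hk => ?_
    exact hb (relE, [k, k + 1]) (List.mem_map.2 ⟨k, by simpa using hk, rfl⟩)
  all_goals
    refine key _ _ rfl (by intro x; simp [vars]; try tauto) fun hb => ?_
    simp only [Holds, Atom.subst, List.mem_cons, List.not_mem_nil, or_false, forall_eq_or_imp,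
      List.map_cons, List.map_nil, forall_eq] at hb
  · exact .node _ _ hb
  · exact .ratioBase _ _ hi hb
  · exact .ratioStep _ _ _ _ _ _ hi hb.1 hb.2.1 hb.2.2
  · exact .residueBase _ hb
  · exact .residueStep _ _ _ _ hi hb.1 hb.2
  · exact .orbitBase _ _ _ hb.1 hb.2
  · exact .orbitStep _ _ _ _ hi hb.1 hb.2.1 hb.2.2

/-! ### Termination when the Conway orbit is bounded -/

/-- With respect to the assignment of positions (a root and a depth) to elements, `x` is exactly
`n` levels deeper than `y`, below the same root. -/
def Deeper (pos : ℕ → ℕ × ℕ) (x y n : ℕ) : Prop :=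
  (pos x).1 = (pos y).1 ∧ (pos x).2 = (pos y).2 + n

/-- The facts about elements of positive depth that are maintained by Datalog rules. -/
structure Layered (p : ℕ) (q r : ℕ → ℕ) (B : ℕ) (pos : ℕ → ℕ × ℕ) (I : Instance) : Prop where
  edge : ∀ z x, ((relE, [z, x]) : Atom) ∈ I → ((pos z).2 = 0 ∧ (pos x).2 = 0) ∨ Deeper pos z x 1
  pow : ∀ j y y', ((relPow j, [y, y']) : Atom) ∈ I → (0 < (pos y').2 ∨ j < (pos y).2) →
    Deeper pos y y' j
  residue : ∀ i x y, ((relR i, [x, y]) : Atom) ∈ I → 0 < (pos y).2 →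
    ∃ n, Deeper pos x y n ∧ n % p = i
  ratio : ∀ i x y z, ((relT i, [x, y, z]) : Atom) ∈ I → 0 < (pos z).2 →
    ∃ t, Deeper pos x z (r i * t) ∧ (q i * t < (pos x).2 → Deeper pos x y (q i * t))
  orbit : ∀ x y, ((relG, [x, y]) : Atom) ∈ I → B < (pos x).2 →
    ∃ n ∈ conwayOrbit p q r, Deeper pos x y n
  halt : ∀ y, ((relH, [y]) : Atom) ∈ I → (pos y).2 = 0

theorem two_mem_conwayOrbit (p : ℕ) (q r : ℕ → ℕ) : 2 ∈ conwayOrbit p q r := ⟨0, rfl⟩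

theorem conway_mem_conwayOrbit {p : ℕ} {q r : ℕ → ℕ} {n : ℕ} (hn : n ∈ conwayOrbit p q r) :
    conway p q r n ∈ conwayOrbit p q r := by
  obtain ⟨k, rfl⟩ := hn
  exact ⟨k + 1, Function.iterate_succ_apply' _ _ _⟩

/-- An edge lowers the depth by one unless both ends have depth `0`. Either alternative of `hpos`
passes to initial segments and keeps the path out of that exceptional case. Both are needed: in the
rule for `T^i` the `r`-track is controlled by its end, the `q`-track by its start. -/
theorem deeper_of_path {p : ℕ} {q r : ℕ → ℕ} {B : ℕ} {pos : ℕ → ℕ × ℕ} {I : Instance}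
    (hI : Layered p q r B pos I) (y : ℕ → ℕ) (j : ℕ)
    (h : ∀ k < j, ((relE, [y k, y (k + 1)]) : Atom) ∈ I)
    (hpos : 0 < (pos (y j)).2 ∨ j < (pos (y 0)).2) : Deeper pos (y 0) (y j) j := by
  induction j with
  | zero => exact ⟨rfl, rfl⟩
  | succ j ih =>
    have ih := ih fun k hk => h k (by omega)
    have he := hI.edge _ _ (h j (by omega))
    simp only [Deeper] at *
    rcases hpos with hpos | hpos
    · have := ih (Or.inl (by omega))
      constructor
      · rw [this.1]; omega
      · omega
    · have := ih (Or.inr (by omega))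
      constructor
      · rw [this.1]; omega
      · omega

/-- The decisive case is the orbit rule: above depth `B` there is room for both the old distance `n`
and the new distance `g(n)`, so the arithmetic takes place entirely at positive depth. -/
theorem Layered.insert {p : ℕ} {q r : ℕ → ℕ} {B : ℕ} {pos : ℕ → ℕ × ℕ} {I : Instance}
    (hqr : ∀ i < p, 0 < q i ∧ 0 < r i)
    (hB : ∀ n ∈ conwayOrbit p q r, n ≤ B) (hI : Layered p q r B pos I) {a : Atom}
    (ha : Derives p q r I a) : Layered p q r B pos (insert a I) := by
  have h2 := hB 2 (two_mem_conwayOrbit p q r)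
  constructor
  · intro z x h
    rcases Finset.mem_insert.1 h with h | h
    · subst h
      -- Rules with another head are excluded by arithmetic on relation names: `relPow`, `relT`,
      -- `relR` lie in the residue classes `1, 2, 0` modulo `3`, above the four fixed names.
      generalize hb : ((relE, [z, x]) : Atom) = b at ha
      cases ha <;> simp [relE, relPow, relN, relT, relR, relG] at hb
      all_goals omega
    · exact hI.edge _ _ h
  · intro j y y' h
    rcases Finset.mem_insert.1 h with h | h
    · subst h
      generalize hb : ((relPow j, [y, y']) : Atom) = b at ha
      cases ha <;> simp [relPow, relN, relT, relR, relG] at hb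
      case pow j' hj y hE =>
        obtain ⟨rfl, rfl, rfl⟩ := hb
        exact deeper_of_path hI y j hE
      all_goals omega
    · exact hI.pow _ _ _ h
  · intro i x y h hy
    rcases Finset.mem_insert.1 h with h | h
    · subst h
      generalize hb : ((relR i, [x, y]) : Atom) = b at ha
      cases ha <;> simp [relPow, relN, relT, relR, relG] at hb
      case residueBase x' _ =>
        obtain ⟨rfl, rfl, rfl⟩ := hb
        exact ⟨0, ⟨rfl, rfl⟩, rfl⟩
      case residueStep i' x' y0 y' hi hR hE =>
        obtain ⟨rfl, rfl, rfl⟩ := hb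
        have he := hI.edge _ _ hE
        simp only [Deeper] at he
        obtain ⟨n, hn, rfl⟩ := hI.residue _ _ _ hR (by omega)
        refine ⟨n + 1, ⟨?_, ?_⟩, ?_⟩
        · rw [hn.1]; omega
        · have := hn.2; omega
        · simp
      all_goals omega
    · exact hI.residue _ _ _ h hy
  · intro i x y z h hz
    rcases Finset.mem_insert.1 h with h | h
    · subst h
      generalize hb : ((relT i, [x, y, z]) : Atom) = b at ha
      cases ha <;> simp [relPow, relN, relT, relR, relG] at hb
      case ratioBase =>
        obtain ⟨rfl, rfl, rfl, rfl⟩ := hb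
        exact ⟨0, ⟨rfl, rfl⟩, fun _ => ⟨rfl, rfl⟩⟩
      case ratioStep i' x' y0 z0 y' z' hi hT hq hr =>
        obtain ⟨rfl, rfl, rfl, rfl⟩ := hb
        have hr' := hI.pow _ _ _ hr (Or.inl hz)
        obtain ⟨t, ht, ht'⟩ := hI.ratio _ _ _ _ hT (by have := hr'.2; omega)
        refine ⟨t + 1, ⟨ht.1.trans hr'.1, ?_⟩, fun hx => ?_⟩
        · rw [ht.2, hr'.2]; ring
        · rw [mul_add, mul_one] at hx ⊢
          have h1 := ht' (by omega)
          have h3 := hI.pow _ _ _ hq (Or.inr (by have := h1.2; omega))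
          refine ⟨h1.1.trans h3.1, ?_⟩
          rw [h1.2, h3.2]; ring
    · exact hI.ratio _ _ _ _ h hz
  · intro x y h hx
    rcases Finset.mem_insert.1 h with h | h
    · subst h
      generalize hb : ((relG, [x, y]) : Atom) = b at ha
      cases ha <;> simp [relPow, relN, relT, relR, relG] at hb
      case orbitBase x' y' z' h h' =>
        obtain ⟨rfl, rfl⟩ := hb
        have e1 := hI.edge _ _ h
        have e2 := hI.edge _ _ h'
        simp only [Deeper] at e1 e2
        refine ⟨2, two_mem_conwayOrbit p q r, ?_, ?_⟩ <;> omega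
      case orbitStep i x' y0 z' hi hR hG hT =>
        obtain ⟨rfl, rfl⟩ := hb
        obtain ⟨n, hn, hd⟩ := hI.orbit _ _ hG hx
        have hnB := hB n hn
        -- Since `n ≤ B < (pos x').2`, the element `y0` has positive depth, so `R^i` gives `i = n %
        -- p` and `T^i` gives `n = r_i t`. Divisibility by `r_i` thus comes from the atom itself.
        have hy : 0 < (pos y0).2 := by have := hd.2; omega
        obtain ⟨n', hd', rfl⟩ := hI.residue _ _ _ hR hy
        obtain rfl : n = n' := by have := hd.2; have := hd'.2; omega
        obtain ⟨t, ht, ht'⟩ := hI.ratio _ _ _ _ hT hy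
        have hnt : n = r (n % p) * t := by have := hd.2; have := ht.2; omega
        have hg : conway p q r n = q (n % p) * t := by
          unfold conway
          conv_lhs => enter [1, 1]; rw [hnt]
          rw [mul_right_comm, mul_assoc, Nat.mul_div_cancel_left _ (hqr _ hi).2, mul_comm]
        have hg' := conway_mem_conwayOrbit hn
        rw [hg] at hg'
        exact ⟨_, hg', ht' (lt_of_le_of_lt (hB _ hg') hx)⟩
      all_goals omega
    · exact hI.orbit _ _ h hx
  · intro y h
    rcases Finset.mem_insert.1 h with h | h
    · subst h
      generalize hb : ((relH, [y]) : Atom) = b at ha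
      cases ha <;> simp [relH, relPow, relN, relT, relR, relG] at hb
    · exact hI.halt _ h

/-- The assignment of positions to the elements of an instance reached by the chase: it is
injective, depths are bounded, and every new element sits directly below an old one. -/
structure Positioned (p : ℕ) (q r : ℕ → ℕ) (B : ℕ) (R : Set ℕ) (pos : ℕ → ℕ × ℕ)
    (I : Instance) : Prop extends Layered p q r B pos I where
  inj : Set.InjOn pos (adom I)
  succ : ∀ x ∈ adom I, 0 < (pos x).2 → ∃ y, ((relE, [x, y]) : Atom) ∈ I ∧ Deeper pos x y 1
  bound : ∀ x ∈ adom I, (pos x).1 ∈ R ∧ (pos x).2 ≤ B + 1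

/-! ### Preservation of positions under chase steps -/

theorem adom_insert (a : Atom) (I : Instance) : adom (insert a I) = {x | x ∈ a.2} ∪ adom I := by
  ext x
  simp [adom]

theorem adom_insert_of_derives {p : ℕ} {q r : ℕ → ℕ} (hqr : ∀ i < p, 0 < q i ∧ 0 < r i)
    {I : Instance} {a : Atom} (ha : Derives p q r I a) : adom (insert a I) = adom I := by
  rw [adom_insert, Set.union_eq_right]
  intro x hx
  have mem : ∀ (n : ℕ) (l : List ℕ), ((n, l) : Atom) ∈ I → ∀ y ∈ l, y ∈ adom I :=
    fun n l h y hy => ⟨_, h, hy⟩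
  cases ha with
  | pow j hj y h =>
    have hj := pos_of_mem_multipliers hqr hj
    simp only [Set.mem_ofPred_eq, List.mem_cons, List.not_mem_nil, or_false] at hx
    rcases hx with rfl | rfl
    · exact mem _ _ (h 0 hj) _ (by simp)
    · obtain ⟨k, rfl⟩ : ∃ k, j = k + 1 := ⟨j - 1, by omega⟩
      exact mem _ _ (h k (by omega)) _ (by simp)
  | node z x h => exact mem _ _ h _ (by simp at hx; simp [hx])
  | ratioBase i x hi h => exact mem _ _ h _ (by simp at hx; simp [hx])
  | residueBase x h => exact mem _ _ h _ (by simp at hx; simp [hx])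
  | ratioStep i x y z y' z' hi h hq hr =>
    simp only [Set.mem_ofPred_eq, List.mem_cons, List.not_mem_nil, or_false] at hx
    rcases hx with rfl | rfl | rfl
    exacts [mem _ _ h _ (by simp), mem _ _ hq _ (by simp), mem _ _ hr _ (by simp)]
  | residueStep i x y y' hi h hE =>
    simp only [Set.mem_ofPred_eq, List.mem_cons, List.not_mem_nil, or_false] at hx
    rcases hx with rfl | rfl
    exacts [mem _ _ h _ (by simp), mem _ _ hE _ (by simp)]
  | orbitBase x y z h h' =>
    simp only [Set.mem_ofPred_eq, List.mem_cons, List.not_mem_nil, or_false] at hx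
    rcases hx with rfl | rfl
    exacts [mem _ _ h _ (by simp), mem _ _ h' _ (by simp)]
  | orbitStep i x y z hi hR hG hT =>
    simp only [Set.mem_ofPred_eq, List.mem_cons, List.not_mem_nil, or_false] at hx
    rcases hx with rfl | rfl
    exacts [mem _ _ hT _ (by simp), mem _ _ hT _ (by simp)]

theorem Layered.congr {p : ℕ} {q r : ℕ → ℕ} {B : ℕ} {pos pos' : ℕ → ℕ × ℕ} {I : Instance}
    (hI : Layered p q r B pos I) (h : ∀ x ∈ adom I, pos' x = pos x) :
    Layered p q r B pos' I := by
  have mem : ∀ (n : ℕ) (l : List ℕ), ((n, l) : Atom) ∈ I → ∀ y ∈ l, pos' y = pos y :=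
    fun n l hn y hy => h y ⟨_, hn, hy⟩
  constructor
  · intro z x ha
    rw [Deeper, mem _ _ ha z (by simp), mem _ _ ha x (by simp)]
    exact hI.edge _ _ ha
  · intro j y y' ha
    rw [Deeper, mem _ _ ha y (by simp), mem _ _ ha y' (by simp)]
    exact hI.pow _ _ _ ha
  · intro i x y ha
    simp only [Deeper]
    rw [mem _ _ ha x (by simp), mem _ _ ha y (by simp)]
    exact hI.residue _ _ _ ha
  · intro i x y z ha
    simp only [Deeper]
    rw [mem _ _ ha x (by simp), mem _ _ ha y (by simp), mem _ _ ha z (by simp)]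
    exact hI.ratio _ _ _ _ ha
  · intro x y ha
    simp only [Deeper]
    rw [mem _ _ ha x (by simp), mem _ _ ha y (by simp)]
    exact hI.orbit _ _ ha
  · intro y ha
    rw [mem _ _ ha y (by simp)]
    exact hI.halt _ ha

theorem Layered.insert_edge {p : ℕ} {q r : ℕ → ℕ} {B : ℕ} {pos : ℕ → ℕ × ℕ} {I : Instance}
    (hI : Layered p q r B pos I) {z x : ℕ} (h : Deeper pos z x 1) :
    Layered p q r B pos (Insert.insert ((relE, [z, x]) : Atom) I) := by
  constructor
  · intro z' x' ha
    rcases Finset.mem_insert.1 ha with ha | ha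
    · simp only [Prod.mk.injEq, List.cons.injEq, and_true, true_and] at ha
      obtain ⟨rfl, rfl⟩ := ha
      exact Or.inr h
    · exact hI.edge _ _ ha
  · intro j y y' ha
    exact hI.pow _ _ _ (Finset.mem_of_mem_insert_of_ne ha (by simp [relE, relPow]))
  · intro i x y ha
    exact hI.residue _ _ _ (Finset.mem_of_mem_insert_of_ne ha (by simp [relE, relR]))
  · intro i x y z ha
    exact hI.ratio _ _ _ _ (Finset.mem_of_mem_insert_of_ne ha (by simp))
  · intro x y ha
    exact hI.orbit _ _ (Finset.mem_of_mem_insert_of_ne ha (by simp [relE, relG]))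
  · intro y ha
    exact hI.halt _ (Finset.mem_of_mem_insert_of_ne ha (by simp))

/-- A Datalog step keeps the positions; a new predecessor of `x` is placed one level below `x`. What
needs proof is that this place is vacant and not too deep. -/
theorem exists_positioned_of_step {p : ℕ} {q r : ℕ → ℕ} {B : ℕ} {R : Set ℕ} {pos : ℕ → ℕ × ℕ}
    {I J : Instance} (hqr : ∀ i < p, 0 < q i ∧ 0 < r i) (hB : ∀ n ∈ conwayOrbit p q r, n ≤ B)
    (hI : Positioned p q r B R pos I) (h : StandardStep (conwayProgram p q r) I J) :
    I.card < J.card ∧ ∃ pos', Positioned p q r B R pos' J := by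
  rcases standardStep_cases hqr h with ⟨a, ha, haI, rfl⟩ | ⟨x, y, z, hG, hH, hE, hz, rfl⟩
  · refine ⟨by rw [Finset.card_insert_of_notMem haI]; omega, pos, hI.toLayered.insert hqr hB ha,
      ?_, ?_, ?_⟩ <;> rw [adom_insert_of_derives hqr ha]
    · exact hI.inj
    · intro x hx hx'
      obtain ⟨y, hy, hy'⟩ := hI.succ x hx hx'
      exact ⟨y, Finset.mem_insert_of_mem hy, hy'⟩
    · exact hI.bound
  · have hzI : ((relE, [z, x]) : Atom) ∉ I := hE z
    have hx : x ∈ adom I := ⟨_, hG, by simp⟩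
    refine ⟨by rw [Finset.card_insert_of_notMem hzI]; omega,
      Function.update pos z ((pos x).1, (pos x).2 + 1), ?_⟩
    set pos' := Function.update pos z ((pos x).1, (pos x).2 + 1) with hpos'
    have hold : ∀ u ∈ adom I, pos' u = pos u := fun u hu =>
      Function.update_of_ne (fun e : u = z => hz (e ▸ hu)) _ _
    have hnew : pos' z = ((pos x).1, (pos x).2 + 1) := Function.update_self _ _ _
    have hzx : Deeper pos' z x 1 := by
      rw [Deeper, hnew, hold x hx]; simp
    have hadom : adom (insert ((relE, [z, x]) : Atom) I) = insert z (adom I) := by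
      rw [adom_insert]
      ext u
      simp only [List.mem_cons, List.not_mem_nil, or_false, Set.mem_union, Set.mem_ofPred_eq,
        Set.mem_insert_iff]
      constructor
      · rintro ((h | rfl) | h)
        exacts [Or.inl h, Or.inr hx, Or.inr h]
      · tauto
    -- Otherwise `y` would lie at distance at most `B` from `x`, hence at positive depth, contrary
    -- to `H(y)`.
    have hbound : (pos x).2 ≤ B := by
      by_contra hlt
      obtain ⟨n, hn, hd⟩ := hI.orbit _ _ hG (by omega)
      have := hB n hn
      have := hI.halt _ hH
      have := hd.2
      omega
    -- An occupant of the place would have an edge to an element at the position of `x`, that is, to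
    -- `x` by injectivity; then the trigger would not be active.
    have hfresh : ∀ u ∈ adom I, pos u ≠ ((pos x).1, (pos x).2 + 1) := by
      intro u hu he
      obtain ⟨v, hv, hd⟩ := hI.succ u hu (by rw [he]; simp)
      have hvx : v = x := by
        refine hI.inj ⟨_, hv, by simp⟩ hx ?_
        simp only [Deeper, he] at hd
        exact Prod.ext hd.1.symm (by omega)
      exact hE u (hvx ▸ hv)
    refine ⟨(hI.toLayered.congr hold).insert_edge hzx, ?_, ?_, ?_⟩ <;> rw [hadom]
    · rw [Set.injOn_insert hz]
      refine ⟨fun u hu v hv huv => hI.inj hu hv (by rwa [hold u hu, hold v hv] at huv), ?_⟩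
      rintro ⟨u, hu, he⟩
      rw [hold u hu, hnew] at he
      exact hfresh u hu he
    · rintro u (rfl | hu) hpos
      · exact ⟨x, Finset.mem_insert_self _ _, hzx⟩
      · rw [hold u hu] at hpos
        obtain ⟨v, hv, hd⟩ := hI.succ u hu hpos
        refine ⟨v, Finset.mem_insert_of_mem hv, ?_⟩
        rwa [Deeper, hold u hu, hold v ⟨_, hv, by simp⟩]
    · rintro u (rfl | hu)
      · rw [hnew]
        exact ⟨(hI.bound x hx).1, by simpa using hbound⟩
      · rw [hold u hu]
        exact hI.bound u hu

/-- Each original element is its own root at depth `0`, so the clauses about positive depth are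
vacuous whatever `D` contains. -/
theorem positioned_initial (p : ℕ) (q r : ℕ → ℕ) (B : ℕ) (D : Instance) :
    Positioned p q r B (adom D) (fun x => (x, 0)) D := by
  refine ⟨⟨?_, ?_, ?_, ?_, ?_, ?_⟩, ?_, ?_, ?_⟩ <;> simp

/-! ### Counting atoms over boundedly many positions -/

theorem finite_adom (I : Instance) : (adom I).Finite := by
  refine (I.finite_toSet.biUnion (t := fun a : Atom => {x | x ∈ a.2})
    fun a _ => List.finite_toSet a.2).subset ?_
  rintro x ⟨a, ha, hx⟩
  exact Set.mem_biUnion (Finset.mem_coe.2 ha) hx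

theorem finite_atoms (S : Finset (ℕ × ℕ)) {V : Set ℕ} (hV : V.Finite) :
    {a : Atom | (a.1, a.2.length) ∈ S ∧ ∀ x ∈ a.2, x ∈ V}.Finite := by
  have := hV.to_subtype
  refine (S.finite_toSet.biUnion (t := fun s =>
    Set.range fun g : Fin s.2 → V => ((s.1, List.ofFn fun i => (g i : ℕ)) : Atom))
    fun s _ => Set.finite_range _).subset ?_
  rintro ⟨n, l⟩ ⟨hS, hl⟩
  refine Set.mem_biUnion (Finset.mem_coe.2 hS) ⟨fun i => ⟨l.get i, hl _ (List.get_mem _ _)⟩, ?_⟩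
  simp

theorem symbol_of_standardStep {P : Program} {I J : Instance} (h : StandardStep P I J) {a : Atom}
    (ha : a ∈ J) : a ∈ I ∨ (a.1, a.2.length) ∈ P.signature := by
  obtain ⟨ρ, hρ, v, -, w, -, -, -, rfl⟩ := h
  simp only [Finset.mem_union, List.mem_toFinset, List.mem_map] at ha
  rcases ha with ha | ⟨b, hb, rfl⟩
  · exact Or.inl ha
  · right
    simp only [Program.signature, List.mem_toFinset, List.mem_map, List.mem_flatMap]
    exact ⟨b, ⟨ρ, hρ, by simp [hb]⟩, by simp [Atom.subst]⟩

/-- Renaming every element to a code of its position embeds the atoms of `I` into a finite set that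
does not depend on the stage of the chase. -/
theorem card_le_of_positioned {p : ℕ} {q r : ℕ → ℕ} {B : ℕ} {R : Set ℕ} {pos : ℕ → ℕ × ℕ}
    {I : Instance} (hI : Positioned p q r B R pos I) {S : Finset (ℕ × ℕ)}
    (hS : ∀ a ∈ I, (a.1, a.2.length) ∈ S) {F : Finset Atom}
    (hF : ∀ a : Atom, (a.1, a.2.length) ∈ S → (∀ x ∈ a.2, x ∈ (fun u : ℕ × ℕ => Nat.pair u.1 u.2) ''
      (R ×ˢ Set.Iic (B + 1))) → a ∈ F) : I.card ≤ F.card := by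
  refine Finset.card_le_card_of_injOn
    (fun a => (a.1, a.2.map fun x => Nat.pair (pos x).1 (pos x).2)) ?_ ?_
  · intro a ha
    refine hF _ (by simpa using hS a ha) ?_
    intro x hx
    simp only [List.mem_map] at hx
    obtain ⟨y, hy, rfl⟩ := hx
    have := hI.bound y ⟨a, ha, hy⟩
    exact ⟨pos y, ⟨this.1, this.2⟩, rfl⟩
  · rintro ⟨n, l⟩ ha ⟨n', l'⟩ ha' h
    simp only [Prod.mk.injEq] at h
    refine Prod.ext h.1 ?_
    have hinj : Set.InjOn (fun x => Nat.pair (pos x).1 (pos x).2) (adom I) := by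
      intro x hx y hy hxy
      rw [Nat.pair_eq_pair] at hxy
      exact hI.inj hx hy (Prod.ext hxy.1 hxy.2)
    obtain ⟨-, hl⟩ := h
    have h1 : ∀ x ∈ l, x ∈ adom I := fun x hx => ⟨_, ha, hx⟩
    have h2 : ∀ x ∈ l', x ∈ adom I := fun x hx => ⟨_, ha', hx⟩
    clear ha ha'
    show l = l'
    induction l generalizing l' with
    | nil => exact (List.map_eq_nil_iff.1 hl.symm).symm
    | cons x l ih =>
      cases l' with
      | nil => simp at hl
      | cons x' l' =>
        simp only [List.map_cons, List.cons.injEq] at hl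
        rw [hinj (h1 x (by simp)) (h2 x' (by simp)) hl.1,
          ih l' hl.2 (fun y hy => h1 y (by simp [hy])) (fun y hy => h2 y (by simp [hy]))]

theorem terminates_of_bddAbove {p : ℕ} {q r : ℕ → ℕ} (hqr : ∀ i < p, 0 < q i ∧ 0 < r i)
    (h : BddAbove (conwayOrbit p q r)) : TerminatesAllInstancesAllPaths (conwayProgram p q r) := by
  obtain ⟨B, hB⟩ := h
  rintro D ⟨s, rfl, hs⟩
  set S : Finset (ℕ × ℕ) := (conwayProgram p q r).signature ∪
    (s 0).image fun a => (a.1, a.2.length) with hSdef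
  have hS : ∀ n, ∀ a ∈ s n, (a.1, a.2.length) ∈ S := by
    intro n
    induction n with
    | zero =>
      intro a ha
      exact Finset.mem_union_right _ (Finset.mem_image_of_mem (fun a : Atom => (a.1, a.2.length)) ha)
    | succ n ih =>
      intro a ha
      rcases symbol_of_standardStep (hs n) ha with h | h
      · exact ih a h
      · exact Finset.mem_union_left _ h
  have hpos : ∀ n, n ≤ (s n).card ∧ ∃ pos, Positioned p q r B (adom (s 0)) pos (s n) := by
    intro n
    induction n with
    | zero => exact ⟨Nat.zero_le _, _, positioned_initial p q r B _⟩
    | succ n ih =>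
      obtain ⟨hn, pos, hp⟩ := ih
      obtain ⟨hc, hp'⟩ := exists_positioned_of_step hqr (fun n hn => hB hn) hp (hs n)
      exact ⟨by omega, hp'⟩
  have hV : ((fun u : ℕ × ℕ => Nat.pair u.1 u.2) ''
      (adom (s 0) ×ˢ Set.Iic (B + 1))).Finite :=
    ((finite_adom _).prod (Set.finite_Iic _)).image _
  have hfin := finite_atoms S hV
  -- After this many steps there are more atoms than the embedding allows.
  obtain ⟨hn, pos, hp⟩ := hpos (hfin.toFinset.card + 1)
  have := card_le_of_positioned hp (hS _) (F := hfin.toFinset) fun a h1 h2 =>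
    hfin.mem_toFinset.2 ⟨h1, h2⟩
  omega

/-! ### Non-termination when the Conway orbit is unbounded -/

/-- The instance contains the chain `m → m - 1 → ⋯ → 0 → 0` of `E`-edges, with `H` true at `0`;
the elements are at most `m`, and `m` has no predecessor. -/
structure Tower (m : ℕ) (I : Instance) : Prop where
  edge : ∀ k ≤ m, ((relE, [k, k - 1]) : Atom) ∈ I
  halt : ((relH, [0]) : Atom) ∈ I
  top : ∀ z, ((relE, [z, m]) : Atom) ∉ I
  le : ∀ x ∈ adom I, x ≤ m

/-- Finitely many chase steps add the atom `a` to any tower of height `m`. -/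
def Reachable (p : ℕ) (q r : ℕ → ℕ) (m : ℕ) (a : Atom) : Prop :=
  ∀ I, Tower m I → ∃ J, Relation.ReflTransGen (StandardStep (conwayProgram p q r)) I J ∧
    I ⊆ J ∧ Tower m J ∧ a ∈ J

theorem reachable_list {p : ℕ} {q r : ℕ → ℕ} {m : ℕ} (l : List Atom)
    (hl : ∀ a ∈ l, Reachable p q r m a) (I : Instance) (hI : Tower m I) :
    ∃ J, Relation.ReflTransGen (StandardStep (conwayProgram p q r)) I J ∧
      I ⊆ J ∧ Tower m J ∧ ∀ a ∈ l, a ∈ J := by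
  induction l with
  | nil => exact ⟨I, .refl, subset_rfl, hI, by simp⟩
  | cons a l ih =>
    obtain ⟨J, h1, h2, h3, h4⟩ := ih fun a ha => hl a (by simp [ha])
    obtain ⟨K, k1, k2, k3, k4⟩ := hl a (by simp) J h3
    refine ⟨K, h1.trans k1, h2.trans k2, k3, ?_⟩
    intro b hb
    rcases List.mem_cons.1 hb with rfl | hb
    exacts [k4, k2 (h4 b hb)]

/-- Datalog rules add neither elements nor `E`-edges, so towers survive them. If the atom is already
present, no step is made, as its trigger would be inactive. -/
theorem reachable_of_derives {p : ℕ} {q r : ℕ → ℕ} {m : ℕ} (hqr : ∀ i < p, 0 < q i ∧ 0 < r i)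
    (l : List Atom) (hl : ∀ a ∈ l, Reachable p q r m a) {a : Atom}
    (ha : ∀ I : Instance, Tower m I → (∀ b ∈ l, b ∈ I) → Derives p q r I a) :
    Reachable p q r m a := by
  intro I hI
  obtain ⟨J, h1, h2, h3, h4⟩ := reachable_list l hl I hI
  by_cases haJ : a ∈ J
  · exact ⟨J, h1, h2, h3, haJ⟩
  · have hd := ha J h3 h4
    refine ⟨insert a J, h1.tail (standardStep_of_derives hqr hd haJ),
      h2.trans (Finset.subset_insert _ _), ⟨?_, ?_, ?_, ?_⟩, Finset.mem_insert_self _ _⟩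
    · exact fun k hk => Finset.mem_insert_of_mem (h3.edge k hk)
    · exact Finset.mem_insert_of_mem h3.halt
    · intro z hz
      rcases Finset.mem_insert.1 hz with hz | hz
      · subst hz
        generalize hb : ((relE, [z, m]) : Atom) = b at hd
        cases hd <;> simp [relE, relPow, relN, relT, relR, relG] at hb
        all_goals omega
      · exact h3.top z hz
    · rw [adom_insert_of_derives hqr hd]
      exact h3.le

section

variable {p : ℕ} {q r : ℕ → ℕ} (hqr : ∀ i < p, 0 < q i ∧ 0 < r i) {m : ℕ}

theorem reachable_edge {k : ℕ} (hk : k ≤ m) : Reachable p q r m (relE, [k, k - 1]) :=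
  fun I hI => ⟨I, .refl, subset_rfl, hI, hI.edge k hk⟩

include hqr

theorem reachable_node : Reachable p q r m (relN, [m]) :=
  reachable_of_derives hqr [] (by simp) fun _ hI _ => .node _ _ (hI.edge m le_rfl)

theorem reachable_pow {j : ℕ} (hj : j ∈ multipliers p q r) {k : ℕ} (hk : k ≤ m) :
    Reachable p q r m (relPow j, [k, k - j]) := by
  refine reachable_of_derives hqr [] (by simp) fun I hI _ => ?_
  -- Truncated subtraction follows the chain and then stays on the loop at `0`; the path may be
  -- longer than the tower is high.
  refine Derives.pow j hj (fun i => k - i) fun i _ => ?_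
  have := hI.edge (k - i) (by omega)
  rwa [Nat.sub_sub] at this

theorem reachable_residue (hp : 0 < p) (n : ℕ) :
    Reachable p q r m (relR (n % p), [m, m - n]) := by
  induction n with
  | zero =>
    refine reachable_of_derives hqr [(relN, [m])] (by simpa using reachable_node hqr) ?_
    intro I _ hl
    simpa using Derives.residueBase (p := p) (q := q) (r := r) m (hl _ (by simp))
  | succ n ih =>
    refine reachable_of_derives hqr [(relR (n % p), [m, m - n]), (relE, [m - n, m - n - 1])] ?_ ?_
    · simpa using ⟨ih, reachable_edge (Nat.sub_le m n)⟩
    · intro I _ hl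
      have := Derives.residueStep (q := q) (r := r) (I := I) (n % p) m (m - n) (m - n - 1)
        (Nat.mod_lt _ hp) (hl _ (by simp)) (hl _ (by simp))
      rwa [Nat.mod_add_mod, Nat.sub_sub] at this

theorem reachable_ratio {i : ℕ} (hi : i < p) (t : ℕ) :
    Reachable p q r m (relT i, [m, m - q i * t, m - r i * t]) := by
  induction t with
  | zero =>
    refine reachable_of_derives hqr [(relN, [m])] (by simpa using reachable_node hqr) ?_
    intro I _ hl
    exact Derives.ratioBase i m hi (hl _ (by simp))
  | succ t ih =>
    refine reachable_of_derives hqr [(relT i, [m, m - q i * t, m - r i * t]),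
      (relPow (q i), [m - q i * t, m - q i * t - q i]),
      (relPow (r i), [m - r i * t, m - r i * t - r i])] ?_ ?_
    · simp only [List.mem_cons, List.not_mem_nil, or_false, forall_eq_or_imp, forall_eq]
      refine ⟨ih, reachable_pow hqr ?_ (Nat.sub_le _ _), reachable_pow hqr ?_ (Nat.sub_le _ _)⟩
      · exact List.mem_append_left _ (List.mem_map_of_mem (List.mem_range.2 hi))
      · exact List.mem_append_right _ (List.mem_map_of_mem (List.mem_range.2 hi))
    · intro I _ hl
      have := Derives.ratioStep (q := q) (r := r) (I := I) i m (m - q i * t) (m - r i * t) (m - q i * t - q i)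
        (m - r i * t - r i) hi (hl _ (by simp)) (hl _ (by simp)) (hl _ (by simp))
      rwa [Nat.sub_sub, Nat.sub_sub, ← Nat.mul_succ, ← Nat.mul_succ] at this

/-- The rules for `T^i` produce only paired distances `q_i t` and `r_i t`; divisibility by `r_i`
supplies the `t` for which these are `g(n)` and `n`. -/
theorem reachable_orbit (hp : 0 < p) (hdvd : ∀ n ∈ conwayOrbit p q r, r (n % p) ∣ n) {n : ℕ}
    (hn : n ∈ conwayOrbit p q r) : Reachable p q r m (relG, [m, m - n]) := by
  obtain ⟨k, rfl⟩ := hn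
  induction k with
  | zero =>
    refine reachable_of_derives hqr [] (by simp) fun I hI _ => ?_
    exact .orbitBase _ (m - 1) _ (hI.edge m le_rfl) (hI.edge (m - 1) (by omega))
  | succ k ih =>
    rw [Function.iterate_succ_apply']
    obtain ⟨t, ht⟩ := hdvd _ ⟨k, rfl⟩
    generalize (conway p q r)^[k] 2 = n at *
    have hi := Nat.mod_lt n hp
    have hg : conway p q r n = q (n % p) * t := by
      unfold conway
      conv_lhs => enter [1, 1]; rw [ht]
      rw [mul_right_comm, mul_assoc, Nat.mul_div_cancel_left _ (hqr _ hi).2, mul_comm]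
    refine reachable_of_derives hqr [(relR (n % p), [m, m - n]), (relG, [m, m - n]),
      (relT (n % p), [m, m - conway p q r n, m - n])] ?_ fun I _ hl => ?_
    · simp only [List.mem_cons, List.not_mem_nil, or_false, forall_eq_or_imp, forall_eq]
      refine ⟨reachable_residue hqr hp n, ih, ?_⟩
      have := reachable_ratio (m := m) hqr hi t
      rwa [← hg, ← ht] at this
    · exact .orbitStep _ m (m - n) _ hi (hl _ (by simp)) (hl _ (by simp)) (hl _ (by simp))

theorem exists_taller_tower (hp : 0 < p) (hdvd : ∀ n ∈ conwayOrbit p q r, r (n % p) ∣ n)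
    (hunb : ¬ BddAbove (conwayOrbit p q r)) {I : Instance} (hI : Tower m I) :
    ∃ J, Relation.TransGen (StandardStep (conwayProgram p q r)) I J ∧ Tower (m + 1) J := by
  obtain ⟨n, hn, hmn⟩ := not_bddAbove_iff.1 hunb m
  obtain ⟨J, h1, -, h3, h4⟩ := reachable_orbit hqr hp hdvd hn I hI
  -- As `m < n`, the orbit atom ends in the well, where `H` holds, and the top of the tower may
  -- receive a predecessor.
  rw [Nat.sub_eq_zero_of_le hmn.le] at h4
  have hfresh : m + 1 ∉ adom J := fun h => by have := h3.le _ h; omega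
  refine ⟨_, .tail' h1 (standardStep_predecessor h4 h3.halt h3.top hfresh), ?_, ?_, ?_, ?_⟩
  · intro k hk
    rcases hk.eq_or_lt with rfl | hk
    · exact Finset.mem_insert_self _ _
    · exact Finset.mem_insert_of_mem (h3.edge k (by omega))
  · exact Finset.mem_insert_of_mem h3.halt
  · intro z hz
    rcases Finset.mem_insert.1 hz with hz | hz
    · simp at hz
    · exact hfresh ⟨_, hz, by simp⟩
  · rw [adom_insert]
    rintro x (hx | hx)
    · simp at hx
      omega
    · have := h3.le x hx
      omega

end

/-- Infinitely many finite non-empty blocks of steps are merged into one path: no element satisfying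
`P` is accessible for the reversed relation, and inaccessibility yields an infinite chain of single
steps. -/
theorem exists_chain_of_forall_transGen {α : Type*} {s : α → α → Prop} {P : α → Prop}
    (h : ∀ a, P a → ∃ b, Relation.TransGen s a b ∧ P b) {a : α} (ha : P a) :
    ∃ f : ℕ → α, f 0 = a ∧ ∀ n, s (f n) (f (n + 1)) := by
  have hacc : ¬ Acc (flip s) a := by
    intro hacc
    have hacc' : Acc (Relation.TransGen (flip s)) a := hacc.transGen
    clear hacc
    induction hacc' with
    | intro a _ ih =>
      obtain ⟨b, hab, hb⟩ := h a ha
      exact ih b (Relation.transGen_swap.2 hab) hb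
  rw [not_acc_iff_exists_descending_chain] at hacc
  exact hacc

theorem tower_wellWithPredecessor (p : ℕ) (q r : ℕ → ℕ) :
    Tower 1 (wellWithPredecessor (conwayProgram p q r)) := by
  have hsig : ∀ ρ ∈ conwayProgram p q r, ∀ a ∈ ρ.1 ++ ρ.2,
      ((a.1, List.replicate a.2.length 0) : Atom) ∈ wellWithPredecessor (conwayProgram p q r) := by
    intro ρ hρ a ha
    refine Finset.mem_insert_of_mem (Finset.mem_image.2 ⟨(a.1, a.2.length), ?_, rfl⟩)
    simp only [Program.signature, List.mem_toFinset, List.mem_map, List.mem_flatMap]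
    exact ⟨a, ⟨ρ, hρ, ha⟩, rfl⟩
  have hρ := (mem_conwayProgram (p := p) (q := q) (r := r)).2 (Or.inl rfl)
  have key : ∀ a ∈ wellWithPredecessor (conwayProgram p q r), a = (relE, [1, 0]) ∨
      ∃ k, a.2 = List.replicate k 0 := by
    intro a ha
    rcases Finset.mem_insert.1 ha with rfl | ha
    · exact Or.inl rfl
    · obtain ⟨s, -, rfl⟩ := Finset.mem_image.1 ha
      exact Or.inr ⟨s.2, rfl⟩
  refine ⟨?_, ?_, ?_, ?_⟩
  · intro k hk
    interval_cases k
    · exact hsig _ hρ (relE, [2, 0]) (by simp)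
    · exact Finset.mem_insert_self _ _
  · exact hsig _ hρ (relH, [1]) (by simp)
  · intro z hz
    rcases key _ hz with h | ⟨k, h⟩
    · simp at h
    · have : (1 : ℕ) ∈ List.replicate k 0 := h ▸ (by simp)
      simp at this
  · rintro x ⟨a, ha, hx⟩
    rcases key _ ha with rfl | ⟨k, h⟩
    · simp at hx
      omega
    · rw [h] at hx
      rw [List.eq_of_mem_replicate hx]
      exact Nat.zero_le _

theorem exists_nonterminatingPath {p : ℕ} {q r : ℕ → ℕ} (hp : 0 < p)
    (hqr : ∀ i < p, 0 < q i ∧ 0 < r i) (hdvd : ∀ n ∈ conwayOrbit p q r, r (n % p) ∣ n)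
    (hunb : ¬ BddAbove (conwayOrbit p q r)) :
    ∃ s : ℕ → Instance, IsNonterminatingPath (conwayProgram p q r)
      (wellWithPredecessor (conwayProgram p q r)) s :=
  exists_chain_of_forall_transGen (P := fun I => ∃ m, Tower m I)
    (fun _ ⟨_, hI⟩ => by
      obtain ⟨J, h1, h2⟩ := exists_taller_tower hqr hp hdvd hunb hI
      exact ⟨J, h1, _, h2⟩)
    ⟨1, tower_wellWithPredecessor p q r⟩

/-! ### Conway codings of counter machines -/

/-- The product of the first `L` primes. -/
noncomputable def primeProduct (L : ℕ) : ℕ := ∏ k ∈ Finset.range L, ThreeCM.prime k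

/-- The number with exponent `v k` at the `k`-th prime, for `k < L`. -/
noncomputable def encodeVec (L : ℕ) (v : ℕ → ℕ) : ℕ := ∏ k ∈ Finset.range L, ThreeCM.prime k ^ v k

theorem prime_prime (k : ℕ) : (ThreeCM.prime k).Prime := Nat.prime_nth_prime k

theorem prime_zero : ThreeCM.prime 0 = 2 := Nat.nth_prime_zero_eq_two

theorem prime_injective : Function.Injective ThreeCM.prime :=
  Nat.nth_injective Nat.infinite_setOfPred_prime

theorem primeProduct_pos (L : ℕ) : 0 < primeProduct L :=
  Finset.prod_pos fun k _ => (prime_prime k).pos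

theorem encodeVec_pos (L : ℕ) (v : ℕ → ℕ) : 0 < encodeVec L v :=
  Finset.prod_pos fun k _ => pow_pos (prime_prime k).pos _

theorem encodeVec_add (L : ℕ) (v w : ℕ → ℕ) :
    encodeVec L (fun k => v k + w k) = encodeVec L v * encodeVec L w := by
  simp only [encodeVec, pow_add, Finset.prod_mul_distrib]

theorem encodeVec_congr {L : ℕ} {v w : ℕ → ℕ} (h : ∀ k < L, v k = w k) :
    encodeVec L v = encodeVec L w :=
  Finset.prod_congr rfl fun k hk => by rw [h k (Finset.mem_range.1 hk)]

theorem encodeVec_single {L k : ℕ} (hk : k < L) (a : ℕ) :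
    encodeVec L (fun j => if j = k then a else 0) = ThreeCM.prime k ^ a := by
  rw [encodeVec, Finset.prod_eq_single k]
  · simp
  · intro j _ hj
    simp [hj]
  · intro h
    exact absurd (Finset.mem_range.2 hk) h

theorem pow_le_encodeVec {L k : ℕ} (hk : k < L) (v : ℕ → ℕ) :
    ThreeCM.prime k ^ v k ≤ encodeVec L v :=
  Nat.le_of_dvd (encodeVec_pos L v)
    (Finset.dvd_prod_of_mem (fun k => ThreeCM.prime k ^ v k) (Finset.mem_range.2 hk))

theorem prime_dvd_encodeVec {L k : ℕ} (hk : k < L) (v : ℕ → ℕ) :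
    ThreeCM.prime k ∣ encodeVec L v ↔ 0 < v k := by
  constructor
  · intro h
    obtain ⟨j, -, hj⟩ := ((prime_prime k).prime.dvd_finsetProd_iff _).1 h
    have hjk := (Nat.prime_dvd_prime_iff_eq (prime_prime k) (prime_prime j)).1
      ((prime_prime k).dvd_of_dvd_pow hj)
    obtain rfl := prime_injective hjk
    by_contra h0
    rw [Nat.eq_zero_of_not_pos h0, pow_zero] at hj
    exact (prime_prime k).one_lt.ne' (Nat.dvd_one.1 hj)
  · intro h
    exact (dvd_pow_self _ h.ne').trans
      (Finset.dvd_prod_of_mem (fun k => ThreeCM.prime k ^ v k) (Finset.mem_range.2 hk))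

theorem prime_dvd_mod_primeProduct {L k : ℕ} (hk : k < L) (n : ℕ) :
    ThreeCM.prime k ∣ n % primeProduct L ↔ ThreeCM.prime k ∣ n :=
  Nat.dvd_mod_iff (Finset.dvd_prod_of_mem _ (Finset.mem_range.2 hk))

/-- Each prime involved divides the modulus, so divisibility by it can be read off the residue, and
it divides the code exactly when its exponent is positive. -/
theorem support_eq_of_mod_eq {L : ℕ} {v w : ℕ → ℕ}
    (h : encodeVec L v % primeProduct L = encodeVec L w % primeProduct L) :
    ∀ k < L, (0 < v k ↔ 0 < w k) := by
  intro k hk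
  rw [← prime_dvd_encodeVec hk, ← prime_dvd_mod_primeProduct hk, h, prime_dvd_mod_primeProduct hk,
    prime_dvd_encodeVec hk]

/-- A machine on exponent vectors whose next move depends on the support of the vector only is
simulated by a Conway function. -/
theorem exists_coding (L : ℕ) {C : Type*} (vec : C → ℕ → ℕ) (nxt : C → C) (up dn : C → ℕ → ℕ)
    (hdn : ∀ c, ∀ k < L, dn c k ≤ vec c k)
    (hnxt : ∀ c, ∀ k < L, vec (nxt c) k = vec c k - dn c k + up c k)
    (hsupp : ∀ c c', (∀ k < L, (0 < vec c k ↔ 0 < vec c' k)) → up c = up c' ∧ dn c = dn c') :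
    ∃ q r : ℕ → ℕ, (∀ i, 0 < q i ∧ 0 < r i) ∧
      ∀ c, r (encodeVec L (vec c) % primeProduct L) ∣ encodeVec L (vec c) ∧
        encodeVec L (vec (nxt c)) = q (encodeVec L (vec c) % primeProduct L) *
          encodeVec L (vec c) / r (encodeVec L (vec c) % primeProduct L) := by
  classical
  have hex : ∀ i, ∃ u d : ℕ → ℕ, ∀ c, encodeVec L (vec c) % primeProduct L = i →
      up c = u ∧ dn c = d := by
    intro i
    by_cases h : ∃ c, encodeVec L (vec c) % primeProduct L = i
    · obtain ⟨c, rfl⟩ := h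
      exact ⟨up c, dn c, fun c' hc' => hsupp _ _ (support_eq_of_mod_eq hc')⟩
    -- Residues attained by no configuration receive the harmless multipliers `q = r = 1`.
    · exact ⟨0, 0, fun c hc => absurd ⟨c, hc⟩ h⟩
  choose u d hud using hex
  refine ⟨fun i => encodeVec L (u i), fun i => encodeVec L (d i),
    fun i => ⟨encodeVec_pos _ _, encodeVec_pos _ _⟩, fun c => ?_⟩
  obtain ⟨hu, hd⟩ := hud _ c rfl
  simp only [← hu, ← hd]
  have h1 : encodeVec L (vec c) = encodeVec L (dn c) * encodeVec L (fun k => vec c k - dn c k) := by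
    rw [← encodeVec_add]
    exact encodeVec_congr fun k hk => by have := hdn c k hk; omega
  have h2 : encodeVec L (vec (nxt c)) =
      encodeVec L (fun k => vec c k - dn c k) * encodeVec L (up c) := by
    rw [← encodeVec_add]
    exact encodeVec_congr fun k hk => hnxt c k hk
  refine ⟨⟨_, h1⟩, ?_⟩
  rw [h2]
  conv_rhs => enter [1, 2]; rw [h1]
  rw [mul_left_comm, Nat.mul_div_cancel_left _ (encodeVec_pos _ _), mul_comm]

/-! ### Bounded and unbounded orbits -/

theorem conwayOrbit_eq_range {p : ℕ} {q r : ℕ → ℕ} {C : Type*} {e : C → ℕ} {nxt : C → C}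
    (h : ∀ c, conway p q r (e c) = e (nxt c)) {c₀ : C} (h₀ : e c₀ = 2) :
    conwayOrbit p q r = Set.range fun k => e (nxt^[k] c₀) := by
  have hs : Function.Semiconj e nxt (conway p q r) := fun c => (h c).symm
  ext x
  simp only [conwayOrbit, ← h₀, Set.mem_ofPred_eq, Set.mem_range, (hs.iterate_right _).eq]

theorem bddAbove_range_of_fixed {C : Type*} (e : C → ℕ) {nxt : C → C} {c₀ : C} {k : ℕ}
    (h : nxt (nxt^[k] c₀) = nxt^[k] c₀) : BddAbove (Set.range fun k => e (nxt^[k] c₀)) := by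
  refine ((Set.finite_Iic k).image fun k => e (nxt^[k] c₀)).bddAbove.mono ?_
  rintro _ ⟨n, rfl⟩
  rcases le_total n k with hn | hn
  · exact ⟨n, Set.mem_Iic.2 hn, rfl⟩
  · refine ⟨k, Set.mem_Iic.2 le_rfl, ?_⟩
    obtain ⟨t, rfl⟩ := Nat.exists_eq_add_of_le' hn
    dsimp only
    rw [Function.iterate_add_apply, Function.iterate_fixed h]

theorem not_bddAbove_range_of_le {f : ℕ → ℕ} (h : ∀ k, k ≤ f k) :
    ¬ BddAbove (Set.range f) := by
  rintro ⟨B, hB⟩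
  have := hB ⟨B + 1, rfl⟩
  have := h (B + 1)
  omega

namespace ThreeCM

/-- The exponents of a configuration. -/
def exponents (M : ThreeCM) (c : Config M) (k : ℕ) : ℕ :=
  if k = c.state then 1 else if k = M.lastState + 1 then c.c₁ else
    if k = M.lastState + 2 then c.c₂ else if k = M.lastState + 3 then c.c₃ else 0

theorem encode_eq (M : ThreeCM) (c : Config M) :
    M.encode c = encodeVec (M.lastState + 1 + 3) (M.exponents c) := by
  have hs := c.state.isLt
  unfold encodeVec encode
  rw [Finset.prod_range_succ, Finset.prod_range_succ, Finset.prod_range_succ]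
  have h : ∏ k ∈ Finset.range (M.lastState + 1), prime k ^ M.exponents c k =
      encodeVec (M.lastState + 1) (fun k => if k = c.state then 1 else 0) := by
    refine Finset.prod_congr rfl fun k hk => ?_
    have := Finset.mem_range.1 hk
    congr 1
    dsimp only [exponents]
    split_ifs <;> omega
  rw [h, encodeVec_single hs, pow_one]
  congr 3 <;> · unfold exponents; split_ifs <;> first | rfl | omega

/-- The exponents removed by the next step, for given state and answers to the zero tests. -/
def removed (M : ThreeCM) (s : Fin (M.lastState + 1)) (z₁ z₂ : Bool) (k : ℕ) : ℕ :=
  match M.instr s z₁ z₂ with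
  | none => 0
  | some (_, o₁, o₂) =>
    if k = s then 1 else if k = M.lastState + 1 then z₁.casesOn (1 - o₁.apply 1) 0 else
      if k = M.lastState + 2 then z₂.casesOn (1 - o₂.apply 1) 0 else 0

/-- The exponents added by the next step, for given state and answers to the zero tests. -/
def added (M : ThreeCM) (s : Fin (M.lastState + 1)) (z₁ z₂ : Bool) (k : ℕ) : ℕ :=
  match M.instr s z₁ z₂ with
  | none => 0
  | some (s', o₁, o₂) =>
    if k = s' then 1 else if k = M.lastState + 1 then o₁.apply 0 else
      if k = M.lastState + 2 then o₂.apply 0 else if k = M.lastState + 3 then 1 else 0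

theorem exists_isConwayCoding (M : ThreeCM) : ∃ q r : ℕ → ℕ, M.IsConwayCoding q r := by
  refine (exists_coding (M.lastState + 1 + 3) M.exponents M.next
    (fun c => M.added c.state (decide (c.c₁ = 0)) (decide (c.c₂ = 0)))
    (fun c => M.removed c.state (decide (c.c₁ = 0)) (decide (c.c₂ = 0))) ?_ ?_ ?_).imp
    fun q => Exists.imp fun r h => ⟨fun i _ => h.1 i, ?_⟩
  · rintro ⟨s, c₁, c₂, c₃⟩ k hk
    simp only [removed, exponents]
    rcases M.instr s (decide (c₁ = 0)) (decide (c₂ = 0)) with _ | ⟨s', o₁, o₂⟩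
    · simp
    · have := s.isLt
      -- The truncated difference `1 - o.apply 1` is `1` for a decrement and `0` otherwise; the zero
      -- test suppresses it on an empty counter.
      have key : ∀ (o : CounterOp) (c : ℕ), (decide (c = 0)).casesOn (1 - o.apply 1) 0 ≤ c := by
        intro o c
        by_cases hc : c = 0
        · simp [hc]
        · cases o <;> simp [hc, CounterOp.apply]
          omega
      dsimp only
      split_ifs
      · rfl
      · exact key _ _
      · exact key _ _
      all_goals exact Nat.zero_le _
  · rintro ⟨s, c₁, c₂, c₃⟩ k hk
    simp only [removed, added, next, step]
    rcases hi : M.instr s (decide (c₁ = 0)) (decide (c₂ = 0)) with _ | ⟨s', o₁, o₂⟩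
    · simp
    · have h1 := s.isLt
      have h2 := s'.isLt
      have key : ∀ (o : CounterOp) (c : ℕ),
          o.apply c = c - (decide (c = 0)).casesOn (1 - o.apply 1) 0 + o.apply 0 := by
        intro o c
        by_cases hc : c = 0 <;> cases o <;> simp [hc, CounterOp.apply]
      simp only [Option.map_some, Option.getD_some, exponents]
      by_cases e1 : k = M.lastState + 1
      · have h3 : k ≠ s := by omega
        have h4 : k ≠ s' := by omega
        simp only [if_neg h3, if_neg h4, if_pos e1]
        exact key _ _
      by_cases e2 : k = M.lastState + 2
      · have h3 : k ≠ s := by omega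
        have h4 : k ≠ s' := by omega
        simp only [if_neg h3, if_neg h4, if_neg e1, if_pos e2]
        exact key _ _
      simp only [if_neg e1, if_neg e2]
      split_ifs <;> omega
  · rintro ⟨s, c₁, c₂, c₃⟩ ⟨s', c₁', c₂', c₃'⟩ hsupp
    have h1 := s.isLt
    have h2 := s'.isLt
    have hs : s = s' := by
      have := hsupp s (by omega)
      simp only [exponents] at this
      by_contra hne
      have hne' : (s : ℕ) ≠ s' := fun e => hne (Fin.ext e)
      simp only [if_true, if_neg hne', if_neg (show (s : ℕ) ≠ M.lastState + 1 by omega),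
        if_neg (show (s : ℕ) ≠ M.lastState + 2 by omega),
        if_neg (show (s : ℕ) ≠ M.lastState + 3 by omega)] at this
      omega
    subst hs
    have hz₁ := hsupp (M.lastState + 1) (by omega)
    have hz₂ := hsupp (M.lastState + 2) (by omega)
    simp only [exponents, if_neg (show M.lastState + 1 ≠ (s : ℕ) by omega),
      if_neg (show M.lastState + 2 ≠ (s : ℕ) by omega), if_true,
      if_neg (show M.lastState + 2 ≠ M.lastState + 1 by omega)] at hz₁ hz₂
    have e₁ : decide (c₁ = 0) = decide (c₁' = 0) := by
      rw [decide_eq_decide]; omega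
    have e₂ : decide (c₂ = 0) = decide (c₂' = 0) := by
      rw [decide_eq_decide]; omega
    simp only [e₁, e₂, and_self]
  · rintro c i - rfl
    rw [encode_eq, encode_eq]
    exact h.2 c

theorem encode_init (M : ThreeCM) : M.encode M.init = 2 := by
  simp [encode, init, prime_zero]

theorem modulus_pos (M : ThreeCM) : 0 < M.modulus := primeProduct_pos _

theorem conway_encode {M : ThreeCM} {q r : ℕ → ℕ} (h : M.IsConwayCoding q r) (c : Config M) :
    conway M.modulus q r (M.encode c) = M.encode (M.next c) := by
  rw [(h.2 c _ (Nat.mod_lt _ M.modulus_pos) rfl).2, conway, mul_comm]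

theorem conwayOrbit_eq {M : ThreeCM} {q r : ℕ → ℕ} (h : M.IsConwayCoding q r) :
    conwayOrbit M.modulus q r = Set.range fun k => M.encode (M.next^[k] M.init) :=
  conwayOrbit_eq_range (conway_encode h) M.encode_init

theorem dvd_of_mem_conwayOrbit {M : ThreeCM} {q r : ℕ → ℕ} (h : M.IsConwayCoding q r) {n : ℕ}
    (hn : n ∈ conwayOrbit M.modulus q r) : r (n % M.modulus) ∣ n := by
  rw [conwayOrbit_eq h] at hn
  obtain ⟨k, rfl⟩ := hn
  exact (h.2 _ _ (Nat.mod_lt _ M.modulus_pos) rfl).1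

theorem halts_iff_bddAbove {M : ThreeCM} {q r : ℕ → ℕ} (h : M.IsConwayCoding q r) :
    M.Halts ↔ BddAbove (conwayOrbit M.modulus q r) := by
  rw [conwayOrbit_eq h]
  constructor
  · rintro ⟨k, hk⟩
    exact bddAbove_range_of_fixed _ (k := k) (by rw [next, hk]; rfl)
  · contrapose
    intro hH
    -- As long as the machine runs, the third counter counts steps, so its prime power alone makes
    -- the orbit unbounded.
    have hclock : ∀ k, (M.next^[k] M.init).c₃ = k := by
      intro k
      induction k with
      | zero => rfl
      | succ k ih =>
        rw [Function.iterate_succ_apply', next]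
        have hne : M.step (M.next^[k] M.init) ≠ none := fun e => hH ⟨k, e⟩
        obtain ⟨c', hc'⟩ := Option.ne_none_iff_exists'.1 hne
        rw [hc']
        rw [step, Option.map_eq_some_iff] at hc'
        obtain ⟨a, -, rfl⟩ := hc'
        simp [ih]
    refine not_bddAbove_range_of_le fun k => ?_
    rw [encode_eq]
    refine le_trans ?_ (pow_le_encodeVec (k := M.lastState + 3) (by omega) _)
    have hs := (M.next^[k] M.init).state.isLt
    have : M.exponents (M.next^[k] M.init) (M.lastState + 3) = k := by
      conv_rhs => rw [← hclock k]
      unfold exponents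
      split_ifs <;> first | rfl | omega
    rw [this]
    exact (Nat.lt_pow_self (prime_prime _).one_lt).le

end ThreeCM

/-! ### Register programs -/

/-- Programs over registers named by natural numbers. Each constructor but `halt` carries the rest
of the program; `loop r b c` repeats `b` while register `r` is non-zero and goes on with `c`. -/
inductive Prog
  | halt
  | inc (r : ℕ) (c : Prog)
  | dec (r : ℕ) (c : Prog)
  | loop (r : ℕ) (b c : Prog)

namespace Prog

/-- Sequential composition. -/
def append : Prog → Prog → Prog
  | halt, k => k
  | inc r c, k => inc r (c.append k)
  | dec r c, k => dec r (c.append k)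
  | loop r b c, k => loop r b (c.append k)

theorem append_assoc (c d k : Prog) : (c.append d).append k = c.append (d.append k) := by
  induction c <;> simp_all [append]

theorem append_halt (c : Prog) : c.append halt = c := by
  induction c <;> simp_all [append]

/-- One step of a program; `halt` is a fixed point. -/
def step : Prog × (ℕ → ℕ) → Prog × (ℕ → ℕ)
  | (halt, v) => (halt, v)
  | (inc r c, v) => (c, Function.update v r (v r + 1))
  | (dec r c, v) => (c, Function.update v r (v r - 1))
  | (loop r b c, v) => if v r = 0 then (c, v) else (b.append (loop r b c), v)

/-- Started with registers `v`, the program `c` terminates with registers `v'`. -/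
def Runs (c : Prog) (v v' : ℕ → ℕ) : Prop := ∀ k, ∃ n, step^[n] (c.append k, v) = (k, v')

theorem Runs.halt (v : ℕ → ℕ) : Runs halt v v := fun _ => ⟨0, rfl⟩

theorem Runs.inc (r : ℕ) (v : ℕ → ℕ) :
    Runs (Prog.inc r .halt) v (Function.update v r (v r + 1)) := fun _ => ⟨1, rfl⟩

theorem Runs.dec (r : ℕ) (v : ℕ → ℕ) :
    Runs (Prog.dec r .halt) v (Function.update v r (v r - 1)) := fun _ => ⟨1, rfl⟩

theorem Runs.append {c d : Prog} {u v w : ℕ → ℕ} (hc : Runs c u v) (hd : Runs d v w) :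
    Runs (c.append d) u w := by
  intro k
  obtain ⟨n, hn⟩ := hc (d.append k)
  obtain ⟨m, hm⟩ := hd k
  refine ⟨m + n, ?_⟩
  rw [Function.iterate_add_apply, append_assoc, hn, hm]

/-- Here `s i` is the register state before passage `i` through the body. The induction runs over
the number of passages still to come. -/
theorem Runs.loop {r : ℕ} {b : Prog} (s : ℕ → ℕ → ℕ) (N : ℕ)
    (hs : ∀ i < N, s i r ≠ 0 ∧ Runs b (s i) (s (i + 1))) (hN : s N r = 0) :
    Runs (loop r b .halt) (s 0) (s N) := by
  intro k
  have key : ∀ j ≤ N, ∃ n, step^[n] (Prog.loop r b k, s (N - j)) = (k, s N) := by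
    intro j hj
    induction j with
    | zero => exact ⟨1, by simp [step, hN]⟩
    | succ j ih =>
      obtain ⟨n, hn⟩ := ih (by omega)
      obtain ⟨h0, hb⟩ := hs (N - (j + 1)) (by omega)
      obtain ⟨m, hm⟩ := hb (Prog.loop r b k)
      rw [show N - (j + 1) + 1 = N - j by omega] at hm
      refine ⟨n + (m + 1), ?_⟩
      rw [Function.iterate_add_apply, Function.iterate_succ_apply, step, if_neg h0, hm, hn]
  simpa [Prog.append] using key N le_rfl

theorem Runs.of_eq {c : Prog} {u v w : ℕ → ℕ} (h : Runs c u v) (hv : ∀ x, v x = w x) :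
    Runs c u w := by
  rwa [← (funext hv : v = w)]

/-- Set register `r` to zero. -/
def clear (r : ℕ) : Prog := loop r (dec r halt) halt

theorem runs_clear (r : ℕ) (v : ℕ → ℕ) : Runs (clear r) v (Function.update v r 0) := by
  have := Runs.loop (r := r) (b := Prog.dec r .halt)
    (fun i => Function.update v r (v r - i)) (v r) ?_ (by simp)
  · rw [Nat.sub_zero, Nat.sub_self, Function.update_eq_self] at this
    exact this
  · intro i hi
    refine ⟨by simp; omega, (Runs.dec r _).of_eq fun x => ?_⟩
    simp only [Function.update_apply]
    split_ifs <;> rfl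

/-- Move the content of register `a` to register `o`. -/
def move (a o : ℕ) : Prog := loop a (dec a (inc o halt)) halt

theorem runs_move {a o : ℕ} (h : a ≠ o) (v : ℕ → ℕ) :
    Runs (move a o) v fun x => if x = a then 0 else if x = o then v o + v a else v x := by
  have := Runs.loop (r := a) (b := Prog.dec a (Prog.inc o .halt))
    (fun i x => if x = a then v a - i else if x = o then v o + i else v x) (v a) ?_ (by simp)
  · convert this using 1
    · rfl
    · funext x
      split_ifs with h1 h2 <;> simp_all
    · simp
  · intro i hi
    refine ⟨by simp; omega, ((Runs.dec a _).append (Runs.inc o _)).of_eq fun x => ?_⟩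
    simp only [Function.update_apply, if_true, if_neg h.symm]
    split_ifs <;> first | rfl | omega

/-- Add the content of register `a` to registers `o` and `b`, and clear `a`. -/
def moveTwice (a o b : ℕ) : Prog := loop a (dec a (inc o (inc b halt))) halt

theorem runs_moveTwice {a o b : ℕ} (h1 : a ≠ o) (h2 : a ≠ b) (h3 : o ≠ b) (v : ℕ → ℕ) :
    Runs (moveTwice a o b) v fun x =>
      if x = a then 0 else if x = o then v o + v a else if x = b then v b + v a else v x := by
  have := Runs.loop (r := a) (b := Prog.dec a (Prog.inc o (Prog.inc b .halt)))
    (fun i x => if x = a then v a - i else if x = o then v o + i else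
      if x = b then v b + i else v x) (v a) ?_ (by simp)
  · convert this using 1
    · rfl
    · funext x
      split_ifs with h1 h2 <;> simp_all
    · simp
  · intro i hi
    refine ⟨by simp; omega,
      ((Runs.dec a _).append ((Runs.inc o _).append (Runs.inc b _))).of_eq fun x => ?_⟩
    simp only [Function.update_apply, if_true, if_neg h1.symm, if_neg h2.symm, if_neg h3.symm]
    split_ifs <;> first | rfl | omega

/-- Copy the content of register `a` to register `o`, using the scratch register `b`. -/
def copy (a o b : ℕ) : Prog := (moveTwice a o b).append (move b a)

theorem runs_copy {a o b : ℕ} (h1 : a ≠ o) (h2 : a ≠ b) (h3 : o ≠ b) {v : ℕ → ℕ} (hb : v b = 0)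
    (ho : v o = 0) : Runs (copy a o b) v (Function.update v o (v a)) := by
  refine ((runs_moveTwice h1 h2 h3 v).append (runs_move h2.symm _)).of_eq fun x => ?_
  simp only [Function.update_apply, if_true, if_neg h2.symm, if_neg h3.symm, hb, ho]
  split_ifs <;> simp_all

/-- Clear the registers `b, …, b + m - 1`. -/
def clearRange (b : ℕ) : ℕ → Prog
  | 0 => halt
  | m + 1 => (clearRange b m).append (clear (b + m))

theorem runs_clearRange (b m : ℕ) (v : ℕ → ℕ) :
    Runs (clearRange b m) v fun x => if b ≤ x ∧ x < b + m then 0 else v x := by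
  induction m with
  | zero => exact (Runs.halt v).of_eq fun x => by rw [if_neg (by omega)]
  | succ m ih =>
    refine (ih.append (runs_clear _ _)).of_eq fun x => ?_
    simp only [Function.update_apply]
    split_ifs <;> first | rfl | omega

/-! ### Primitive recursive functions on registers -/

/-- `f` is computed by a program that reads its arguments from given registers, puts the value into
a given register, and leaves all other registers, among them its scratch registers from `b` on,
as they were. -/
def Computable {n : ℕ} (f : List.Vector ℕ n → ℕ) : Prop :=
  ∀ (ins : Fin n → ℕ) (out b : ℕ), (∀ i, ins i < b) → out < b → (∀ i, ins i ≠ out) →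
    ∃ c : Prog, ∀ v : ℕ → ℕ, (∀ x, b ≤ x → v x = 0) → v out = 0 →
      Runs c v (Function.update v out (f (List.Vector.ofFn fun i => v (ins i))))

theorem computable_zero : Computable (n := 0) fun _ => 0 := by
  intro ins out b _ _ _
  refine ⟨.halt, fun v _ h0 => (Runs.halt v).of_eq fun x => ?_⟩
  simp only [Function.update_apply]
  split_ifs with h <;> simp_all

theorem computable_get {n : ℕ} (i : Fin n) : Computable fun v => v.get i := by
  intro ins out b hi ho hio
  refine ⟨copy (ins i) out b, fun v hv h0 => ?_⟩
  have := hi i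
  simp only [List.Vector.get_ofFn]
  exact runs_copy (hio i) (by omega) (by omega) (hv b le_rfl) h0

theorem computable_succ : Computable (n := 1) fun v => v.head.succ := by
  intro ins out b hi ho hio
  refine ⟨(copy (ins 0) out b).append (.inc out .halt), fun v hv h0 => ?_⟩
  have := hi 0
  refine ((runs_copy (hio 0) (by omega) (by omega) (hv b le_rfl) h0).append
    (Runs.inc out _)).of_eq fun x => ?_
  simp only [Function.update_apply, if_true]
  split_ifs <;> rfl

/-- The outputs occupy `b, …, b + n - 1`. The scratch space of every `g i` starts at `b + n`, so
earlier outputs are not disturbed; this is why `k` and `n` are kept apart in the induction. -/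
theorem exists_runs_outputs {m n : ℕ} {g : Fin n → List.Vector ℕ m → ℕ}
    (hg : ∀ i, Computable (g i)) (ins : Fin m → ℕ) (b : ℕ) (hi : ∀ i, ins i < b) (k : ℕ)
    (hk : k ≤ n) : ∃ c : Prog, ∀ v : ℕ → ℕ, (∀ x, b ≤ x → v x = 0) →
      Runs c v fun x => if h : b ≤ x ∧ x < b + k then
        g ⟨x - b, by omega⟩ (List.Vector.ofFn fun i => v (ins i)) else v x := by
  induction k with
  | zero => exact ⟨.halt, fun v _ => (Runs.halt v).of_eq fun x => by rw [dif_neg (by omega)]⟩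
  | succ k ih =>
    obtain ⟨c, hc⟩ := ih (by omega)
    obtain ⟨d, hd⟩ := hg ⟨k, by omega⟩ ins (b + k) (b + n) (fun i => by have := hi i; omega)
      (by omega) (fun i => by have := hi i; omega)
    refine ⟨c.append d, fun v hv => ((hc v hv).append (hd _ ?_ ?_)).of_eq fun x => ?_⟩
    · intro x hx
      rw [dif_neg (by omega), hv x (by omega)]
    · rw [dif_neg (by omega), hv _ (by omega)]
    · have hins : (fun i => if h : b ≤ ins i ∧ ins i < b + k then
          g ⟨ins i - b, by omega⟩ (List.Vector.ofFn fun i => v (ins i)) else v (ins i)) =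
          fun i => v (ins i) := by
        funext i
        rw [dif_neg (by have := hi i; omega)]
      simp only [Function.update_apply]
      rw [hins]
      by_cases hx : x = b + k
      · subst hx
        rw [if_pos rfl, dif_pos (by omega)]
        simp only [Nat.add_sub_cancel_left]
      · rw [if_neg hx]
        by_cases hx' : b ≤ x ∧ x < b + k
        · rw [dif_pos hx', dif_pos (by omega)]
        · rw [dif_neg hx', dif_neg (by omega)]

theorem computable_comp {m n : ℕ} {f : List.Vector ℕ n → ℕ} {g : Fin n → List.Vector ℕ m → ℕ}
    (hf : Computable f) (hg : ∀ i, Computable (g i)) :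
    Computable fun a => f (List.Vector.ofFn fun i => g i a) := by
  intro ins out b hi ho hio
  obtain ⟨c, hc⟩ := exists_runs_outputs hg ins b hi n le_rfl
  obtain ⟨d, hd⟩ := hf (fun i => b + i) out (b + n) (fun i => by omega) (by omega)
    (fun i => by omega)
  refine ⟨(c.append d).append (clearRange b n), fun v hv h0 =>
    (((hc v hv).append (hd _ ?_ ?_)).append (runs_clearRange b n _)).of_eq fun x => ?_⟩
  · intro x hx
    rw [dif_neg (by omega), hv x (by omega)]
  · rw [dif_neg (by omega), h0]
  · have hg' : (fun i : Fin n => if h : b ≤ b + (i : ℕ) ∧ b + (i : ℕ) < b + n then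
        g ⟨b + (i : ℕ) - b, by omega⟩ (List.Vector.ofFn fun i => v (ins i)) else v (b + i)) =
        fun i => g i (List.Vector.ofFn fun i => v (ins i)) := by
      funext i
      rw [dif_pos (by omega)]
      simp only [Nat.add_sub_cancel_left, Fin.eta]
    rw [hg']
    simp only [Function.update_apply]
    by_cases hx : x = out
    · rw [if_pos hx, if_neg (by omega), if_pos hx]
    · rw [if_neg hx, if_neg hx]
      by_cases hx' : b ≤ x ∧ x < b + n
      · rw [if_pos hx', hv x hx'.1]
      · rw [if_neg hx', dif_neg hx']

theorem computable_prec {n : ℕ} {f : List.Vector ℕ n → ℕ} {g : List.Vector ℕ (n + 2) → ℕ}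
    (hf : Computable f) (hg : Computable g) :
    Computable fun v : List.Vector ℕ (n + 1) =>
      v.head.rec (f v.tail) fun y IH => g (y ::ᵥ IH ::ᵥ v.tail) := by
  intro ins out b hi ho hio
  have hi0 := hi 0
  obtain ⟨cf, hcf⟩ := hf (fun i => ins i.succ) b (b + 4) (fun i => by have := hi i.succ; omega)
    (by omega) (fun i => by have := hi i.succ; omega)
  obtain ⟨cg, hcg⟩ := hg (Fin.cons (b + 1) (Fin.cons b fun i => ins i.succ)) (b + 3) (b + 4)
    (by
      intro i
      refine Fin.cases (by simp) (fun i => Fin.cases (by simp) (fun i => ?_) i) i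
      have := hi i.succ
      simp only [Fin.cons_succ]
      omega) (by omega)
    (by
      intro i
      refine Fin.cases (by simp) (fun i => Fin.cases (by simp) (fun i => ?_) i) i
      have := hi i.succ
      simp only [Fin.cons_succ]
      omega)
  -- Register `b` holds the accumulated value, `b + 1` the recursion index, `b + 2` the passages
  -- left and `b + 3` the next value; scratch space for `f` and `g` starts at `b + 4`.
  refine ⟨((copy (ins 0) (b + 2) (b + 3)).append cf).append
    ((loop (b + 2) (cg.append ((clear b).append ((move (b + 3) b).append
      (inc (b + 1) (dec (b + 2) .halt))))) .halt).append
        ((clear (b + 1)).append (move b out))), fun v hv h0 => ?_⟩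
  set tl := List.Vector.ofFn fun i : Fin n => v (ins i.succ) with htl
  set R : ℕ → ℕ := fun i => Nat.rec (f tl) (fun y IH => g (y ::ᵥ IH ::ᵥ tl)) i with hR
  set s : ℕ → ℕ → ℕ := fun i x => if x = b then R i else if x = b + 1 then i else
    if x = b + 2 then v (ins 0) - i else v x with hs
  have h1 : Runs ((copy (ins 0) (b + 2) (b + 3)).append cf) v (s 0) := by
    refine ((runs_copy (by omega) (by omega) (by omega) (hv _ (by omega))
      (hv _ (by omega))).append (hcf _ ?_ ?_)).of_eq fun x => ?_
    · intro x hx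
      rw [Function.update_of_ne (by omega), hv x (by omega)]
    · rw [Function.update_of_ne (by omega), hv b (by omega)]
    · have : (fun i : Fin n => Function.update v (b + 2) (v (ins 0)) (ins i.succ)) =
          fun i => v (ins i.succ) := by
        funext i
        rw [Function.update_of_ne (by have := hi i.succ; omega)]
      rw [this]
      simp only [hs, hR, Function.update_apply]
      by_cases e1 : x = b + 1
      · rw [if_neg (by omega), if_neg (by omega), if_neg (by omega), if_pos e1, hv x (by omega)]
      · rw [if_neg e1]
        rfl
  have h2 := Runs.loop (r := b + 2) (b := cg.append ((clear b).append ((move (b + 3) b).append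
      (inc (b + 1) (dec (b + 2) .halt))))) s (v (ins 0)) ?_ ?_
  · refine (h1.append (h2.append ((runs_clear _ _).append (runs_move (by omega) _)))).of_eq
      fun x => ?_
    have : (List.Vector.ofFn fun i : Fin (n + 1) => v (ins i)) = v (ins 0) ::ᵥ tl := rfl
    rw [this]
    simp only [List.Vector.head_cons, List.Vector.tail_cons, Function.update_apply, hs]
    by_cases e0 : x = out
    · subst e0
      simp only [if_true]
      rw [if_neg (by omega), if_neg (by omega), if_neg (by omega), if_neg (by omega),
        if_neg (by omega), if_neg (by omega), h0, zero_add]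
    · rw [if_neg e0, if_neg e0]
      by_cases e1 : x = b
      · rw [if_pos e1, hv x (by omega)]
      · rw [if_neg e1, if_neg e1]
        by_cases e2 : x = b + 1
        · rw [if_pos e2, hv x (by omega)]
        · rw [if_neg e2, if_neg e2]
          by_cases e3 : x = b + 2
          · rw [if_pos e3, hv x (by omega), Nat.sub_self]
          · rw [if_neg e3]
  · intro i hi'
    refine ⟨?_, ?_⟩
    · simp only [hs]
      rw [if_neg (by omega), if_neg (by omega), if_pos trivial]
      omega
    · refine ((hcg (s i) ?_ ?_).append ((runs_clear _ _).append ((runs_move (by omega) _).append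
        ((Runs.inc _ _).append (Runs.dec _ _))))).of_eq fun x => ?_
      · intro x hx
        simp only [hs]
        rw [if_neg (by omega), if_neg (by omega), if_neg (by omega), hv x (by omega)]
      · simp only [hs]
        rw [if_neg (by omega), if_neg (by omega), if_neg (by omega), hv _ (by omega)]
      · have hin : (List.Vector.ofFn fun j : Fin (n + 2) => s i
            ((Fin.cons (b + 1) (Fin.cons b fun i => ins i.succ) : Fin (n + 2) → ℕ) j)) =
            i ::ᵥ R i ::ᵥ tl := by
          have e1 : s i (b + 1) = i := by simp [hs]
          have e2 : s i b = R i := by simp [hs]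
          have e3 : (fun j : Fin n => s i (ins j.succ)) = fun j => v (ins j.succ) := by
            funext j
            have := hi j.succ
            simp only [hs]
            rw [if_neg (by omega), if_neg (by omega), if_neg (by omega)]
          have : (List.Vector.ofFn fun j : Fin (n + 2) => s i
            ((Fin.cons (b + 1) (Fin.cons b fun i => ins i.succ) : Fin (n + 2) → ℕ) j)) =
            s i (b + 1) ::ᵥ s i b ::ᵥ List.Vector.ofFn fun j : Fin n => s i (ins j.succ) := rfl
          rw [this, e1, e2, e3]
        rw [hin]
        have hRs : g (i ::ᵥ R i ::ᵥ tl) = R (i + 1) := rfl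
        rw [hRs]
        simp only [Function.update_apply, hs, if_true]
        by_cases e0 : x = b
        · subst e0
          simp
        by_cases e1 : x = b + 1
        · subst e1
          simp
        by_cases e2 : x = b + 2
        · subst e2
          simp
          omega
        by_cases e3 : x = b + 3
        · subst e3
          simp
          exact (hv _ (by omega)).symm
        simp [e0, e1, e2, e3]
  · simp only [hs]
    rw [if_neg (by omega), if_neg (by omega), if_pos trivial, Nat.sub_self]

theorem computable_of_primrec {n : ℕ} {f : List.Vector ℕ n → ℕ} (hf : Nat.Primrec' f) :
    Computable f := by
  induction hf with
  | zero => exact computable_zero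
  | succ => exact computable_succ
  | get i => exact computable_get i
  | comp g _ _ hf hg => exact computable_comp hf hg
  | prec _ _ hf hg => exact computable_prec hf hg

end Prog

namespace Prog

/-! ### Unbounded search by a register program -/

/-- Started with the input `n` in register `0`, the program `c` terminates. -/
def HaltsOn (c : Prog) (n : ℕ) : Prop := ∃ k, (step^[k] (c, Pi.single 0 n)).1 = halt

theorem step_halt (v : ℕ → ℕ) : step (halt, v) = (halt, v) := rfl

theorem iterate_step_halt {k : ℕ} {x : Prog × (ℕ → ℕ)} (h : (step^[k] x).1 = halt) {n : ℕ}
    (hn : k ≤ n) : (step^[n] x).1 = halt := by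
  obtain ⟨t, rfl⟩ := Nat.exists_eq_add_of_le' hn
  rw [Function.iterate_add_apply]
  generalize step^[k] x = y at h
  obtain ⟨c, v⟩ := y
  simp only at h
  subst h
  rw [Function.iterate_fixed (step_halt v)]

/-- The program tries `t = 0, 1, …` in register `1`, computes `h n t` into register `2` and loops
while that value is non-zero. -/
theorem exists_haltsOn_iff {h : ℕ → ℕ → ℕ} (hh : Primrec₂ h) :
    ∃ c : Prog, ∀ n, c.HaltsOn n ↔ ∃ t, h n t = 0 := by
  obtain ⟨d, hd⟩ := computable_of_primrec (Nat.Primrec'.prim_iff₂.2 hh) (fun i => (i : ℕ)) 2 3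
    (fun i => by omega) (by omega) (fun i => by omega)
  set b := (clear 2).append ((inc 1 halt).append d) with hb
  refine ⟨d.append (loop 2 b halt), fun n => ?_⟩
  set s : ℕ → ℕ → ℕ := fun i x => if x = 0 then n else if x = 1 then i else
    if x = 2 then h n i else 0 with hs
  have hval : ∀ v : ℕ → ℕ, (List.Vector.ofFn fun i : Fin 2 => v i) = v 0 ::ᵥ v 1 ::ᵥ .nil :=
    fun v => rfl
  have h0 : Runs d (Pi.single 0 n) (s 0) := by
    refine (hd _ (fun x hx => Pi.single_eq_of_ne (by omega) _)
      (Pi.single_eq_of_ne (by omega) _)).of_eq fun x => ?_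
    rw [hval]
    by_cases e0 : x = 0
    · subst e0
      simp [hs]
    · simp [hs, e0, Function.update_apply]
      omega
  have hstep : ∀ i, Runs b (s i) (s (i + 1)) := by
    intro i
    refine ((runs_clear _ _).append ((Runs.inc _ _).append (hd _ ?_ ?_))).of_eq fun x => ?_
    · intro x hx
      simp only [hs, Function.update_apply]
      rw [if_neg (by omega), if_neg (by omega), if_neg (by omega), if_neg (by omega),
        if_neg (by omega)]
    · simp
    · rw [hval]
      simp only [hs, Function.update_apply, List.Vector.head_cons, List.Vector.tail_cons]
      by_cases e0 : x = 0
      · simp [e0]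
      by_cases e1 : x = 1
      · simp [e1]
      by_cases e2 : x = 2
      · simp [e2]
      simp [e0, e1, e2]
  constructor
  · contrapose!
    rintro hne ⟨k, hk⟩
    -- Without a zero of `h` the program is at the loop head at arbitrarily late times, whereas a
    -- halted program stays halted.
    have key : ∀ i, ∃ N, i ≤ N ∧
        step^[N] (d.append (loop 2 b halt), Pi.single 0 n) = (loop 2 b halt, s i) := by
      intro i
      induction i with
      | zero =>
        obtain ⟨N, hN⟩ := h0 (loop 2 b halt)
        exact ⟨N, Nat.zero_le _, hN⟩
      | succ i ih =>
        obtain ⟨N, hN, hN'⟩ := ih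
        obtain ⟨m, hm⟩ := hstep i (loop 2 b halt)
        refine ⟨m + (1 + N), by omega, ?_⟩
        rw [Function.iterate_add_apply, Function.iterate_add_apply, hN', Function.iterate_one, step,
          if_neg (by simpa [hs] using hne i), hm]
    obtain ⟨N, hN, hN'⟩ := key k
    have := iterate_step_halt hk hN
    rw [hN'] at this
    simp at this
  · rintro hex
    classical
    have hloop := Runs.loop (r := 2) (b := b) s (Nat.find hex)
      (fun i hi => ⟨by simpa [hs] using Nat.find_min hex hi, hstep i⟩)
      (by simpa [hs] using Nat.find_spec hex)
    obtain ⟨k, hk⟩ := (h0.append hloop) halt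
    rw [append_halt] at hk
    exact ⟨k, by rw [hk]⟩

/-! ### The finite control of a register program -/

/-- The control states that occur while the program `c` runs with continuation `k`. -/
def controls : Prog → Prog → Set Prog
  | halt, k => {k}
  | inc r c, k => insert (inc r (c.append k)) (controls c k)
  | dec r c, k => insert (dec r (c.append k)) (controls c k)
  | loop r b c, k =>
    insert (loop r b (c.append k)) (controls b (loop r b (c.append k)) ∪ controls c k)

theorem finite_controls (c k : Prog) : (controls c k).Finite := by
  induction c generalizing k with
  | halt => exact Set.finite_singleton k
  | inc r c ih => exact (ih k).insert _
  | dec r c ih => exact (ih k).insert _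
  | loop r b c ihb ihc => exact ((ihb _).union (ihc k)).insert _

theorem append_mem_controls (c k : Prog) : c.append k ∈ controls c k := by
  cases c with
  | halt => exact Set.mem_singleton k
  | inc r c => exact Set.mem_insert _ _
  | dec r c => exact Set.mem_insert _ _
  | loop r b c => exact Set.mem_insert _ _

/-- Control can leave the set only at the continuation `k`. For a loop body the continuation is the
loop itself, so leaving the body leads back to the head. -/
theorem step_mem_controls {c k x : Prog} (hx : x ∈ controls c k) (v : ℕ → ℕ) :
    x = k ∨ (step (x, v)).1 ∈ controls c k := by
  induction c generalizing k with
  | halt => exact Or.inl hx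
  | inc r c ih =>
    rcases hx with rfl | hx
    · exact Or.inr (Set.mem_insert_of_mem _ (append_mem_controls c k))
    · exact (ih hx).imp_right (Set.mem_insert_of_mem _)
  | dec r c ih =>
    rcases hx with rfl | hx
    · exact Or.inr (Set.mem_insert_of_mem _ (append_mem_controls c k))
    · exact (ih hx).imp_right (Set.mem_insert_of_mem _)
  | loop r b c ihb ihc =>
    have hhead : (step (loop r b (c.append k), v)).1 ∈ controls (loop r b c) k := by
      simp only [step]
      split_ifs
      · exact Or.inr (Or.inr (append_mem_controls c k))
      · exact Or.inr (Or.inl (append_mem_controls b _))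
    rcases hx with rfl | hx | hx
    · exact Or.inr hhead
    · rcases ihb hx with rfl | h
      · exact Or.inr hhead
      · exact Or.inr (Or.inr (Or.inl h))
    · exact (ihc hx).imp_right fun h => Or.inr (Or.inr h)

theorem step_mem_controls_halt {c x : Prog} (hx : x ∈ controls c halt) (v : ℕ → ℕ) :
    (step (x, v)).1 ∈ controls c halt := by
  rcases step_mem_controls hx v with rfl | h
  · exact hx
  · exact h

/-- The register that the next step of the program depends on. -/
def reg : Prog → ℕ
  | halt => 0
  | inc r _ => r
  | dec r _ => r
  | loop r _ _ => r

/-- The next control and the amounts added to and removed from each register depend only on whether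
one register is empty, as the support condition of `Chase.exists_coding` requires. -/
theorem step_congr (c : Prog) {v v' : ℕ → ℕ} (h : 0 < v c.reg ↔ 0 < v' c.reg) :
    (step (c, v)).1 = (step (c, v')).1 ∧
      (∀ j, (step (c, v)).2 j - v j = (step (c, v')).2 j - v' j) ∧
      ∀ j, v j - (step (c, v)).2 j = v' j - (step (c, v')).2 j := by
  cases c with
  | halt => simp [step]
  | inc r c =>
    refine ⟨rfl, fun j => ?_, fun j => ?_⟩ <;> simp only [step, Function.update_apply] <;>
      split_ifs with hj <;> simp [hj]
  | dec r c =>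
    simp only [reg] at h
    refine ⟨rfl, fun j => ?_, fun j => ?_⟩ <;> simp only [step, Function.update_apply] <;>
      split_ifs with hj <;> first | (subst hj; omega) | omega
  | loop r b c =>
    simp only [reg] at h
    have : v r = 0 ↔ v' r = 0 := by omega
    by_cases h0 : v r = 0
    · simp [step, h0, this.1 h0]
    · simp [step, h0, mt this.2 h0]

/-! ### Register programs as Conway functions -/

/-- The configurations of the program `c` with a clock: control state, registers, clock. -/
abbrev Conf (c : Prog) := {x : Prog // x ∈ controls c halt} × (ℕ → ℕ) × ℕ

open Classical in
/-- The next configuration; the clock runs until the program halts. -/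
noncomputable def Conf.next {c : Prog} (x : Conf c) : Conf c :=
  if x.1.1 = halt then x else
    (⟨(step (x.1.1, x.2.1)).1, step_mem_controls_halt x.1.2 x.2.1⟩, (step (x.1.1, x.2.1)).2,
      x.2.2 + 1)

/-- The initial configuration with input `n`. -/
def Conf.init (c : Prog) (n : ℕ) : Conf c :=
  (⟨c, by simpa [append_halt] using append_mem_controls c halt⟩, Pi.single 0 n, 0)

/-- Exponents of a configuration: the odd places hold the control state (numbered by `e`), place
`2` the clock, and place `2 j + 4` the register `j`. -/
def exponents (e : Prog → ℕ) (c : Prog) (v : ℕ → ℕ) (t k : ℕ) : ℕ :=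
  if k % 2 = 1 then (if k = 2 * e c + 1 then 1 else 0) else
    if k = 0 then 0 else if k = 2 then t else v (k / 2 - 2)

theorem exponents_register (e : Prog → ℕ) (c : Prog) (v : ℕ → ℕ) (t j : ℕ) :
    exponents e c v t (2 * j + 4) = v j := by
  unfold exponents
  rw [if_neg (by omega), if_neg (by omega), if_neg (by omega)]
  congr 1
  omega

theorem exponents_control (e : Prog → ℕ) (c : Prog) (v : ℕ → ℕ) (t : ℕ) :
    exponents e c v t (2 * e c + 1) = 1 := by
  unfold exponents
  rw [if_pos (by omega), if_pos rfl]

theorem encodeVec_init {L : ℕ} {e : Prog → ℕ} {c : Prog} (he : 2 * e c + 1 < L) (hL : 4 < L)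
    (n : ℕ) : encodeVec L (exponents e c (Pi.single 0 n) 0) =
      ThreeCM.prime (2 * e c + 1) * ThreeCM.prime 4 ^ n := by
  have h1 := encodeVec_single he 1
  rw [pow_one] at h1
  rw [← h1, ← encodeVec_single hL n, ← encodeVec_add]
  refine encodeVec_congr fun k _ => ?_
  unfold exponents
  by_cases hk : k % 2 = 1
  · rw [if_pos hk, if_neg (show k ≠ 4 by omega), add_zero]
  · rw [if_neg hk, if_neg (show k ≠ 2 * e c + 1 by omega), zero_add]
    by_cases h4 : k = 4
    · subst h4
      simp
    · rw [if_neg h4]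
      split_ifs
      · rfl
      · rfl
      · exact Pi.single_eq_of_ne (by omega) _

open Classical in
theorem exists_coding {c : Prog} {e : Prog → ℕ} (he : Set.InjOn e (controls c halt)) {L : ℕ}
    (hL : ∀ x ∈ controls c halt, 2 * e x + 1 < L ∧ 2 * x.reg + 4 < L) :
    ∃ q r : ℕ → ℕ, (∀ i, 0 < q i ∧ 0 < r i) ∧ ∀ x : Conf c,
      r (encodeVec L (exponents e x.1.1 x.2.1 x.2.2) % primeProduct L) ∣
        encodeVec L (exponents e x.1.1 x.2.1 x.2.2) ∧
      encodeVec L (exponents e x.next.1.1 x.next.2.1 x.next.2.2) =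
        q (encodeVec L (exponents e x.1.1 x.2.1 x.2.2) % primeProduct L) *
          encodeVec L (exponents e x.1.1 x.2.1 x.2.2) /
            r (encodeVec L (exponents e x.1.1 x.2.1 x.2.2) % primeProduct L) := by
  classical
  -- The vector added consists of the new control, the register increments and one clock tick; the
  -- vector removed, of the old control and the register decrements. At `halt` both vanish.
  refine Chase.exists_coding L (fun x : Conf c => exponents e x.1.1 x.2.1 x.2.2) Conf.next
    (fun x => if x.1.1 = halt then 0 else
      exponents e (step (x.1.1, x.2.1)).1 (fun j => (step (x.1.1, x.2.1)).2 j - x.2.1 j) 1)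
    (fun x => if x.1.1 = halt then 0 else
      exponents e x.1.1 (fun j => x.2.1 j - (step (x.1.1, x.2.1)).2 j) 0) ?_ ?_ ?_
  · rintro ⟨⟨x, hx⟩, v, t⟩ k -
    by_cases h : x = halt
    · simp [h]
    · simp only [if_neg h, exponents]
      split_ifs <;> omega
  · rintro ⟨⟨x, hx⟩, v, t⟩ k -
    by_cases h : x = halt
    · simp [h, Conf.next]
    · simp only [if_neg h, exponents, Conf.next]
      split_ifs <;> omega
  · rintro ⟨⟨x, hx⟩, v, t⟩ ⟨⟨x', hx'⟩, v', t'⟩ hsupp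
    have hxx : x = x' := by
      have h := hsupp (2 * e x + 1) (hL x hx).1
      simp only [exponents_control] at h
      refine he hx hx' ?_
      by_contra hne
      simp only [exponents] at h
      rw [if_pos (by omega), if_neg (by omega)] at h
      omega
    subst hxx
    have h := hsupp _ (hL x hx).2
    simp only [exponents_register] at h
    obtain ⟨h1, h2, h3⟩ := step_congr x h
    simp only [h1, funext h2, funext h3, and_self]

theorem conf_iterate {c : Prog} (n k : ℕ) :
    ((Conf.next^[k] (Conf.init c n)).1.1, (Conf.next^[k] (Conf.init c n)).2.1) =
      step^[k] (c, Pi.single 0 n) := by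
  refine ((show Function.Semiconj (fun x : Conf c => (x.1.1, x.2.1)) Conf.next step from ?_).iterate_right
    k).eq (Conf.init c n)
  rintro ⟨⟨x, hx⟩, v, t⟩
  by_cases h : x = halt
  · subst h
    simp [Conf.next, step]
  · simp [Conf.next, h]

theorem conf_clock {c : Prog} {n : ℕ} (h : ¬ c.HaltsOn n) (k : ℕ) :
    (Conf.next^[k] (Conf.init c n)).2.2 = k := by
  induction k with
  | zero => rfl
  | succ k ih =>
    have hne : (Conf.next^[k] (Conf.init c n)).1.1 ≠ halt := fun e =>
      h ⟨k, by rw [← conf_iterate, e]⟩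
    rw [Function.iterate_succ_apply', Conf.next, if_neg hne]
    simp [ih]

/-- All data except the multiplier at residue `2` are independent of the input. The first
application of the function replaces the start `2` by the code `a * b ^ n` of the initial
configuration. -/
theorem exists_conway (c : Prog) : ∃ (p : ℕ) (q₀ r : ℕ → ℕ) (a b : ℕ), 0 < p ∧ ∀ n : ℕ,
    (∀ i, 0 < Function.update q₀ 2 (a * b ^ n) i ∧ 0 < r i) ∧
    (∀ m ∈ conwayOrbit p (Function.update q₀ 2 (a * b ^ n)) r, r (m % p) ∣ m) ∧
    (c.HaltsOn n ↔ BddAbove (conwayOrbit p (Function.update q₀ 2 (a * b ^ n)) r)) := by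
  obtain ⟨e, he⟩ := Set.countable_iff_exists_injOn.1 (finite_controls c halt).countable
  obtain ⟨B, hB⟩ := ((finite_controls c halt).image fun x => max (2 * e x + 1) (2 * x.reg + 4)).bddAbove
  obtain ⟨L, hL4, hL⟩ : ∃ L, 4 < L ∧ ∀ x ∈ controls c halt, 2 * e x + 1 < L ∧ 2 * x.reg + 4 < L := by
    refine ⟨B + 5, by omega, fun x hx => ?_⟩
    have := hB ⟨x, hx, rfl⟩
    simp only [max_le_iff] at this
    omega
  obtain ⟨q₀, r₀, hpos, hcode⟩ := exists_coding he hL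
  have hcL := (hL c (by simpa [append_halt] using append_mem_controls c halt)).1
  have hp : 2 < primeProduct L := by
    have h3 : ThreeCM.prime 1 ∣ primeProduct L :=
      Finset.dvd_prod_of_mem _ (Finset.mem_range.2 (by omega))
    have h3' : ThreeCM.prime 1 = 3 := Nat.nth_prime_one_eq_three
    rw [h3'] at h3
    exact Nat.le_of_dvd (primeProduct_pos L) h3
  refine ⟨primeProduct L, q₀, Function.update r₀ 2 2, ThreeCM.prime (2 * e c + 1),
    ThreeCM.prime 4, primeProduct_pos L, fun n => ?_⟩
  set q := Function.update q₀ 2 (ThreeCM.prime (2 * e c + 1) * ThreeCM.prime 4 ^ n) with hq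
  set r := Function.update r₀ 2 2 with hr
  -- The extra configuration `none`, with code `2`, precedes the initial one.
  set enc : Option (Conf c) → ℕ :=
    fun x => x.elim 2 fun x => encodeVec L (exponents e x.1.1 x.2.1 x.2.2) with henc
  set nxt : Option (Conf c) → Option (Conf c) :=
    fun x => some (x.elim (Conf.init c n) Conf.next) with hnxt
  -- The control state sits at an odd place, so its prime is not `2`; it divides both the code and
  -- the modulus, hence the residue. Changing `q` and `r` at `2` therefore leaves the simulation
  -- intact.
  have hmod : ∀ x : Conf c, enc (some x) % primeProduct L ≠ 2 := by
    intro x h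
    have hk := (hL x.1.1 x.1.2).1
    have h1 := (prime_dvd_encodeVec hk (exponents e x.1.1 x.2.1 x.2.2)).2
      (by rw [exponents_control]; exact one_pos)
    rw [← prime_dvd_mod_primeProduct hk] at h1
    simp only [henc, Option.elim_some] at h
    rw [h, ← prime_zero, Nat.prime_dvd_prime_iff_eq (prime_prime _) (prime_prime _)] at h1
    have := prime_injective h1
    omega
  have hstep : ∀ x, r (enc x % primeProduct L) ∣ enc x ∧
      conway (primeProduct L) q r (enc x) = enc (nxt x) := by
    rintro (_ | x)
    · have h2 : enc none % primeProduct L = 2 := Nat.mod_eq_of_lt hp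
      refine ⟨by rw [h2, hr, Function.update_self]; exact dvd_rfl, ?_⟩
      rw [conway, h2, hr, hq, Function.update_self, Function.update_self]
      simp only [henc, hnxt, Option.elim_none, Option.elim_some, Conf.init]
      rw [encodeVec_init hcL hL4, Nat.mul_div_cancel_left _ two_pos]
    · obtain ⟨h1, h2⟩ := hcode x
      rw [conway, hr, hq, Function.update_of_ne (hmod x), Function.update_of_ne (hmod x)]
      refine ⟨h1, ?_⟩
      rw [mul_comm]
      exact h2.symm
  have horb : conwayOrbit (primeProduct L) q r = Set.range fun k => enc (nxt^[k] none) :=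
    conwayOrbit_eq_range (fun x => (hstep x).2) rfl
  have hiter : ∀ k, nxt^[k + 1] none = some (Conf.next^[k] (Conf.init c n)) := by
    intro k
    induction k with
    | zero => rfl
    | succ k ih =>
      rw [Function.iterate_succ_apply', ih, Function.iterate_succ_apply']
      rfl
  refine ⟨fun i => ⟨?_, ?_⟩, ?_, ?_⟩
  · simp only [hq, Function.update_apply]
    split_ifs
    · exact Nat.mul_pos (prime_prime _).pos (pow_pos (prime_prime _).pos _)
    · exact (hpos i).1
  · simp only [hr, Function.update_apply]
    split_ifs
    · exact two_pos
    · exact (hpos i).2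
  · intro m hm
    rw [horb] at hm
    obtain ⟨k, rfl⟩ := hm
    exact (hstep _).1
  · rw [horb]
    constructor
    · rintro ⟨k, hk⟩
      refine bddAbove_range_of_fixed enc (k := k + 1) ?_
      rw [hiter]
      rw [← conf_iterate] at hk
      simp only [hnxt, Option.elim_some]
      rw [Conf.next, if_pos hk]
    · contrapose
      intro hH
      refine not_bddAbove_range_of_le fun k => ?_
      cases k with
      | zero => exact Nat.zero_le _
      | succ k =>
        rw [hiter]
        simp only [henc, Option.elim_some]
        -- Place `2` is the clock, which reads `k` at orbit index `k + 1` because of the extra first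
        -- step.
        refine le_trans ?_ (pow_le_encodeVec (k := 2) (by omega) _)
        have : exponents e (Conf.next^[k] (Conf.init c n)).1.1 (Conf.next^[k] (Conf.init c n)).2.1
            (Conf.next^[k] (Conf.init c n)).2.2 2 = k := by
          rw [conf_clock hH]
          rfl
        rw [this]
        exact Nat.lt_pow_self (prime_prime _).one_lt

end Prog

/-! ### Undecidability -/

/-- As the length `p` is fixed, it suffices that each entry is primitive recursive in `n`
separately; no uniformity in `i` is needed. -/
theorem primrec_map_range {β : Type*} [Primcodable β] {F : ℕ → ℕ → β} (p : ℕ)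
    (hF : ∀ i, Primrec fun n => F n i) : Primrec fun n => (List.range p).map (F n) := by
  induction p with
  | zero => exact Primrec.const []
  | succ p ih =>
    simp only [List.range_succ, List.map_append, List.map_cons, List.map_nil]
    exact Primrec.list_append.comp ih (Primrec.list_cons.comp (hF p) (Primrec.const []))

/-- The rule `E(y₀,y₁), …, E(y_{j-1},y_j) ⇒ E^j(y₀,y_j)`. -/
def powRule (j : ℕ) : TGD :=
  ((List.range j).map fun k => (relE, [k, k + 1]), [(relPow j, [0, j])])

theorem primrec_singleton {α : Type*} [Primcodable α] : Primrec fun a : α => [a] :=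
  Primrec.list_cons.comp Primrec.id (Primrec.const [])

theorem primrec_relPow : Primrec relPow :=
  Primrec.nat_add.comp (Primrec.const 4) (Primrec.nat_mul.comp (Primrec.const 3) Primrec.id)

theorem primrec_powRule : Primrec powRule := by
  refine Primrec.pair (Primrec.list_map Primrec.list_range ?_) ?_
  · exact Primrec.pair (Primrec.const relE)
      (Primrec.list_cons.comp Primrec.snd
        (primrec_singleton.comp (Primrec.succ.comp Primrec.snd)))
  · exact primrec_singleton.comp (Primrec.pair primrec_relPow
      (Primrec.list_cons.comp (Primrec.const 0) primrec_singleton))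

/-- With `p` and `r` fixed, only the `E^j` rules for `j = q_i` and the recursive rules for `T^i`
vary. -/
theorem primrec_conwayProgram (p : ℕ) {q : ℕ → ℕ → ℕ} (r : ℕ → ℕ)
    (hq : ∀ i, Primrec fun n => q n i) : Primrec fun n => conwayProgram p (q n) r := by
  unfold conwayProgram multipliers
  refine Primrec.list_append.comp (Primrec.list_append.comp (Primrec.list_append.comp
    (Primrec.list_append.comp (Primrec.list_append.comp (Primrec.list_append.comp
      (Primrec.list_append.comp (Primrec.list_append.comp (Primrec.const _) ?_)
        (Primrec.const _)) (Primrec.const _)) ?_) (Primrec.const _)) (Primrec.const _))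
        (Primrec.const _)) (Primrec.const _)
  · simp only [List.map_append, List.map_map]
    refine Primrec.list_append.comp (primrec_map_range p fun i => ?_) (Primrec.const _)
    exact primrec_powRule.comp (hq i)
  · refine primrec_map_range p fun i => Primrec.pair ?_ (Primrec.const _)
    refine Primrec.list_cons.comp (Primrec.const _) (Primrec.list_cons.comp
      (Primrec.pair (primrec_relPow.comp (hq i)) (Primrec.const _)) (Primrec.const _))

/-! ### Reduction from the halting problem -/

theorem terminates_iff_bddAbove {p : ℕ} {q r : ℕ → ℕ} (hp : 0 < p)
    (hqr : ∀ i < p, 0 < q i ∧ 0 < r i) (hdvd : ∀ n ∈ conwayOrbit p q r, r (n % p) ∣ n) :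
    TerminatesAllInstancesAllPaths (conwayProgram p q r) ↔ BddAbove (conwayOrbit p q r) := by
  refine ⟨fun h => ?_, terminates_of_bddAbove hqr⟩
  by_contra hunb
  exact h _ (exists_nonterminatingPath hp hqr hdvd hunb)

-- A universal register program: it searches for a step bound at which the primitive recursive
-- evaluator `evaln` returns a value.
open Nat.Partrec.Code in
theorem exists_prog_haltsOn_iff_eval_dom : ∃ c : Prog, ∀ d : Nat.Partrec.Code,
    c.HaltsOn (Encodable.encode d) ↔ (eval d 0).Dom := by
  have hh : Primrec₂ fun n t : ℕ =>
      bif (evaln t (Denumerable.ofNat Nat.Partrec.Code n) 0).isSome then 0 else 1 := by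
    have hargs : Primrec fun x : ℕ × ℕ =>
        ((x.2, Denumerable.ofNat Nat.Partrec.Code x.1), (0 : ℕ)) :=
      Primrec.pair (Primrec.pair Primrec.snd ((Primrec.ofNat _).comp Primrec.fst))
        (Primrec.const 0)
    exact Primrec.cond (Primrec.option_isSome.comp (primrec_evaln.comp hargs)) (Primrec.const 0)
      (Primrec.const 1)
  obtain ⟨c, hc⟩ := Prog.exists_haltsOn_iff hh
  refine ⟨c, fun d => (hc _).trans ?_⟩
  simp only [Denumerable.ofNat_encode, Part.dom_iff_mem, evaln_complete]
  constructor
  · rintro ⟨t, ht⟩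
    rcases he : evaln t d 0 with _ | x
    · simp [he] at ht
    · exact ⟨x, t, he⟩
  · rintro ⟨x, t, he⟩
    rw [Option.mem_def] at he
    exact ⟨t, by simp [he]⟩

theorem termination_undecidable :
    ¬ ∃ f : Program → Bool, Computable f ∧ ∀ P : Program, P.IsSingleHeadTernary →
      (f P = true ↔ TerminatesAllInstancesAllPaths P) := by
  rintro ⟨f, hf, hdec⟩
  obtain ⟨c, hc⟩ := exists_prog_haltsOn_iff_eval_dom
  obtain ⟨p, q₀, r, a, b, hp, h⟩ := Prog.exists_conway c
  have hprog : Primrec fun n => conwayProgram p (Function.update q₀ 2 (a * b ^ n)) r := by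
    refine primrec_conwayProgram p r fun i => ?_
    by_cases hi : i = 2
    · subst hi
      simp only [Function.update_self]
      have hpow : Primrec fun n : ℕ => b ^ n :=
        (Primrec.nat_rec₁ 1 (Primrec.nat_mul.comp Primrec.snd (Primrec.const b)).to₂).of_eq
          fun n => by
            induction n with
            | zero => rfl
            | succ n ih => rw [pow_succ, ← ih]
      exact Primrec.nat_mul.comp (Primrec.const a) hpow
    · simp only [Function.update_of_ne hi]
      exact Primrec.const _
  have key : ∀ d : Nat.Partrec.Code,
      f (conwayProgram p (Function.update q₀ 2 (a * b ^ Encodable.encode d)) r) = true ↔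
        (Nat.Partrec.Code.eval d 0).Dom := by
    intro d
    obtain ⟨h1, h2, h3⟩ := h (Encodable.encode d)
    rw [hdec _ (isSingleHeadTernary_conwayProgram fun i _ => h1 i),
      terminates_iff_bddAbove hp (fun i _ => h1 i) h2, ← h3, hc]
  -- A decision procedure, composed with the computable map from codes to rule programs, would
  -- decide halting on input `0`.
  refine ComputablePred.halting_problem 0 (ComputablePred.computable_iff.2
    ⟨fun d => f (conwayProgram p (Function.update q₀ 2 (a * b ^ Encodable.encode d)) r), ?_, ?_⟩)
  · exact hf.comp (hprog.to_comp.comp Computable.encode)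
  · funext d
    exact propext (key d).symm

end Chase

theorem mainTheorem2 :
    (¬ ∃ f : Chase.Program → Bool, Computable f ∧
      ∀ P : Chase.Program, P.IsSingleHeadTernary →
        (f P = true ↔ Chase.TerminatesAllInstancesAllPaths P)) ∧
    ∀ M : Chase.ThreeCM,
      (∃ q r : ℕ → ℕ, M.IsConwayCoding q r) ∧
      ∀ q r : ℕ → ℕ, M.IsConwayCoding q r →
        (M.program q r).IsSingleHeadTernary ∧
        (M.Halts ↔ BddAbove (Chase.conwayOrbit M.modulus q r)) ∧
        (BddAbove (Chase.conwayOrbit M.modulus q r) →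
          Chase.TerminatesAllInstancesAllPaths (M.program q r)) ∧
        (¬ BddAbove (Chase.conwayOrbit M.modulus q r) →
          ∃ s : ℕ → Chase.Instance,
            Chase.IsNonterminatingPath (M.program q r)
              (Chase.wellWithPredecessor (M.program q r)) s) := by
  refine ⟨Chase.termination_undecidable, fun M => ⟨M.exists_isConwayCoding, fun q r h => ?_⟩⟩
  exact ⟨Chase.isSingleHeadTernary_conwayProgram h.1, Chase.ThreeCM.halts_iff_bddAbove h,
    Chase.terminates_of_bddAbove h.1, Chase.exists_nonterminatingPath M.modulus_pos h.1
      fun _ hn => Chase.ThreeCM.dvd_of_mem_conwayOrbit h hn⟩
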